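/- Let $n\ge 1$, $s\in(0,1)$ and $p>1$. Write $B_\rho$ for the open ball of radius $\rho$ centred at the origin of $\mathbf R^n$ and $\mathcal H^{n-1}$ for the $(n-1)$-dimensional Hausdorff measure, and set $$[f]_{W^{s,p}(B_R)}:=\Big(\int_{B_R}\int_{B_R}\frac{|f(x)-f(y)|^p}{|x-y|^{n+sp}}\,dx\,dy\Big)^{1/p},\qquad [g]_{W^{s,p}(\partial B_t)}:=\Big(\int_{\partial B_t}\int_{\partial B_t}\frac{|g(x)-g(y)|^p}{|x-y|^{n-1+sp}}\,d\mathcal H^{n-1}(x)\,d\mathcal H^{n-1}(y)\Big)^{1/p}$$ (with the integrands equal to $0$ for $x=y$). Then there is a constant $C=C(n,s,p)>0$ with the following property. Let $m\ge 0$, let $\phi$ be a standard mollifier on $\mathbf R^n$ (that is, $\phi\in C^\infty(\mathbf R^n)$, $\phi\ge0$, $\phi=0$ outside $\overline{B_1}$ and $\int\phi=1$), and put $\phi_\varepsilon:=\varepsilon^{-n}\phi(\cdot/\varepsilon)$. Let $f\in W^{s,p}(B_1,\mathbf R^m)$, i.e. $f\in L^p(B_1,\mathbf R^m)$ and $[f]_{W^{s,p}(B_1)}<\infty$.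 Call $x\in B_1$ an $L^p$-Lebesgue point of $f$ if there is $z\in\mathbf R^m$ such that $$\lim_{\rho\downarrow0}\frac{1}{|B_\rho(x)|}\int_{B_\rho(x)}|f(y)-z|^p\,dy=0;$$ let $S_f$ be the set of points of $B_1$ that are not $L^p$-Lebesgue points of $f$, and let $\tilde f\colon B_1\setminus S_f\to\mathbf R^m$, $\tilde f(x):=z$, be the precise representative (set to $0$ on $S_f$). In the convolution $f*\phi_\varepsilon$ the function $f$ is extended by zero outside $B_1$. Then for all $0<r<R<1$ with $R\le 100r$ there is a measurable set $G\subset(r,R)$ with $\mathscr L^1(G)>0$ such that for all $t\in G$: (a) $\mathcal H^{n-1}(S_f\cap\partial B_t)=0$; (b) $\tilde f\in L^p(\partial B_t,\mathcal H^{n-1})$ and $\|\tilde f-f*\phi_\varepsilon\|_{L^p(\partial B_t)}\to0$ as $\varepsilon\downarrow0$; (c) $[\tilde f]_{W^{s,p}(\partial B_t)}\le C\,(R-r)^{-1/p}\,[f]_{W^{s,p}(B_R)}$. -/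

import Mathlib

open MeasureTheory Set Filter Topology
open scoped ENNReal ContDiff

noncomputable section

/-- The Gagliardo seminorm `[f]_{W^{s,p}(B_R)}` on the ball `B_R ⊆ ℝⁿ` centred at the origin, as an
extended nonnegative real. (On the diagonal the quotient is `0 / 0 = 0`.) -/
def gagliardoBall {n m : ℕ} (s p R : ℝ)
    (f : EuclideanSpace ℝ (Fin n) → EuclideanSpace ℝ (Fin m)) : ℝ≥0∞ :=
  (∫⁻ x in Metric.ball (0 : EuclideanSpace ℝ (Fin n)) R,
    ∫⁻ y in Metric.ball (0 : EuclideanSpace ℝ (Fin n)) R,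
      ‖f x - f y‖ₑ ^ p / edist x y ^ ((n : ℝ) + s * p)) ^ (1 / p)

/-- The surface measure `𝓗^{n-1}` restricted to the sphere `∂B_t ⊆ ℝⁿ` centred at the origin. -/
def sphereMeasure (n : ℕ) (t : ℝ) : Measure (EuclideanSpace ℝ (Fin n)) :=
  (μHE[n - 1]).restrict (Metric.sphere (0 : EuclideanSpace ℝ (Fin n)) t)

/-- The Gagliardo seminorm `[g]_{W^{s,p}(∂B_t)}` on the sphere `∂B_t ⊆ ℝⁿ` centred at the origin, as
an extended nonnegative real. (On the diagonal the quotient is `0 / 0 = 0`.) -/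
def gagliardoSphere {n m : ℕ} (s p t : ℝ)
    (g : EuclideanSpace ℝ (Fin n) → EuclideanSpace ℝ (Fin m)) : ℝ≥0∞ :=
  (∫⁻ x, ∫⁻ y,
      ‖g x - g y‖ₑ ^ p / edist x y ^ ((n : ℝ) - 1 + s * p)
    ∂(sphereMeasure n t) ∂(sphereMeasure n t)) ^ (1 / p)

/-- `f ∈ W^{s,p}(B_1, ℝᵐ)`: only the values of `f` on the open unit ball matter. -/
def MemWsp {n m : ℕ} (s p : ℝ)
    (f : EuclideanSpace ℝ (Fin n) → EuclideanSpace ℝ (Fin m)) : Prop :=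
  MemLp f (ENNReal.ofReal p)
      (volume.restrict (Metric.ball (0 : EuclideanSpace ℝ (Fin n)) 1)) ∧
    gagliardoBall s p 1 f < ⊤

/-- `z` is the `L^p`-Lebesgue value of `f` at `x`:
the averages of `|f - z|^p` over the balls `B_ρ(x)` tend to `0` as `ρ ↓ 0`. -/
def IsLebesgueValue {n m : ℕ} (p : ℝ)
    (f : EuclideanSpace ℝ (Fin n) → EuclideanSpace ℝ (Fin m))
    (x : EuclideanSpace ℝ (Fin n)) (z : EuclideanSpace ℝ (Fin m)) : Prop :=
  Tendsto
    (fun ρ : ℝ => (∫⁻ y in Metric.ball x ρ, ‖f y - z‖ₑ ^ p) / volume (Metric.ball x ρ))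
    (𝓝[>] 0) (𝓝 0)

/-- The set `S_f` of the points of `B_1` that are not `L^p`-Lebesgue points of `f`. -/
def singularSet {n m : ℕ} (p : ℝ)
    (f : EuclideanSpace ℝ (Fin n) → EuclideanSpace ℝ (Fin m)) :
    Set (EuclideanSpace ℝ (Fin n)) :=
  {x ∈ Metric.ball 0 1 | ¬ ∃ z, IsLebesgueValue p f x z}

open Classical in
/-- The precise representative `f̃`: at an `L^p`-Lebesgue point it is the Lebesgue value
(which is unique for `f ∈ L^p(B_1)`); at all other points it is set to `0`. -/
def preciseRep {n m : ℕ} (p : ℝ)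
    (f : EuclideanSpace ℝ (Fin n) → EuclideanSpace ℝ (Fin m))
    (x : EuclideanSpace ℝ (Fin n)) : EuclideanSpace ℝ (Fin m) :=
  if h : ∃ z, IsLebesgueValue p f x z then h.choose else 0

/-- A standard mollifier on `ℝⁿ`: smooth, nonnegative, supported in the closed unit ball and of
integral one. (Radial symmetry is not required.) -/
structure IsStandardMollifier {n : ℕ} (φ : EuclideanSpace ℝ (Fin n) → ℝ) : Prop where
  contDiff : ContDiff ℝ ∞ φ
  nonneg : ∀ x, 0 ≤ φ x
  support_subset : Function.support φ ⊆ Metric.closedBall 0 1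
  integral_eq_one : ∫ x, φ x = 1

/-- The mollification `f * φ_ε`, with `φ_ε = ε⁻ⁿ φ(· / ε)` and `f` extended by zero outside `B_1`. -/
def mollify {n m : ℕ} (φ : EuclideanSpace ℝ (Fin n) → ℝ)
    (f : EuclideanSpace ℝ (Fin n) → EuclideanSpace ℝ (Fin m)) (ε : ℝ) :
    EuclideanSpace ℝ (Fin n) → EuclideanSpace ℝ (Fin m) :=
  MeasureTheory.convolution (fun x => (ε ^ n)⁻¹ * φ (ε⁻¹ • x))
    ((Metric.ball (0 : EuclideanSpace ℝ (Fin n)) 1).indicator f)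
    (ContinuousLinearMap.lsmul ℝ ℝ) volume

end

/-!
Everything follows from the finiteness of the Gagliardo density
`h_R(x) = ∫_{B_R} |f(x) - f(y)|^p / |x - y|^{n + sp} dy`, whose integral over `B_R` is
`[f]_{W^{s,p}(B_R)}^p`.

If `h_1(x) < ∞`, then the average of `|f - f(x)|^p` over `B_ρ(x)` is `O(ρ^{sp})`. So `f(x)` is the
`L^p`-Lebesgue value at `x` (`isLebesgueValue_of_gagliardoDensity_lt_top`), and by Hölder's
inequality `|f(x) - (f * φ_ε)(x)| ≤ M ε^s h_1(x)^{1/p}` (`exists_enorm_sub_mollify_le`). By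
integration in polar coordinates `h_1` is integrable over `∂B_t` for almost every `t`, and for all
these `t` assertions (a) and (b) hold; neither Lebesgue's differentiation theorem nor a maximal
function is needed, and the whole family `ε ↓ 0` converges.

For (c), two points `x`, `y` of `∂B_t` are compared with the points `z` of the ball of radius
`|x - y| / 4` that touches `∂B_t` at `x` from inside. This bounds the integrand on the sphere by
averages of `|f(x) - f(z)|^p` and `|f(y) - f(z)|^p` (`enorm_sub_rpow_mul_le_nearEnergy`). After
exchanging the integrals, the tail bound
`∫_{y ∈ ∂B_t, |x - y| ≥ ρ} |x - y|^{-(2n - 1 + sp)} ≤ C ρ^{-(n + sp)}` shows that the energy on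
`∂B_t` is at most `C ∫_{∂B_t} h_R` for every `t < R`
(`exists_lintegral_polarMeasure_gagliardo_le`). Integrating over `t ∈ (r, R)` gives at most
`C [f]_{W^{s,p}(B_R)}^p`, and on a set of positive measure of radii the energy does not exceed its
mean value.

The surface measure in polar coordinates is Mathlib's cone measure `Measure.toSphere`. Only the
upper bound of the Hausdorff measure by a multiple of the cone measure is needed; it follows from
Vitali's covering theorem and the lower Ahlfors regularity of the cone measure
(`exists_sphereMeasure_le_smul_polarMeasure`).
-/

/-! ### Integration in polar coordinates -/

/-- The cone (surface) measure on the sphere `∂B_t`: the pushforward of Mathlib's measure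
`volume.toSphere` on the unit sphere under dilation by `t`, multiplied by `t ^ (n - 1)`. -/
noncomputable def polarMeasure (n : ℕ) (t : ℝ) : Measure (EuclideanSpace ℝ (Fin n)) :=
  ENNReal.ofReal (t ^ (n - 1)) •
    Measure.map (fun ξ : Metric.sphere (0 : EuclideanSpace ℝ (Fin n)) 1 =>
      t • (ξ : EuclideanSpace ℝ (Fin n))) (volume : Measure (EuclideanSpace ℝ (Fin n))).toSphere

section Polar

variable {n : ℕ}

local notation "E" => EuclideanSpace ℝ (Fin n)

instance (t : ℝ) : IsFiniteMeasure (polarMeasure n t) := by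
  unfold polarMeasure
  exact Measure.smul_finite _ ENNReal.ofReal_ne_top

theorem lintegral_polarMeasure {g : E → ℝ≥0∞} (hg : Measurable g) (t : ℝ) :
    ∫⁻ x, g x ∂polarMeasure n t = ENNReal.ofReal (t ^ (n - 1)) *
      ∫⁻ ξ : Metric.sphere (0 : E) 1, g (t • (ξ : E)) ∂(volume : Measure E).toSphere := by
  rw [polarMeasure, lintegral_smul_measure, lintegral_map hg (by fun_prop), smul_eq_mul]

theorem ae_polarMeasure_mem_sphere {t : ℝ} (ht : 0 ≤ t) :
    ∀ᵐ x ∂polarMeasure n t, x ∈ Metric.sphere (0 : E) t := by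
  refine Measure.ae_smul_measure ?_ _
  rw [ae_map_iff (by fun_prop) (p := (· ∈ Metric.sphere (0 : E) t))
    (Metric.isClosed_sphere.measurableSet)]
  filter_upwards with ξ
  simp [norm_smul, abs_of_nonneg ht]

theorem measurable_lintegral_polarMeasure {α : Type*} [MeasurableSpace α]
    {g : α → E → ℝ≥0∞} (hg : Measurable (Function.uncurry g)) {τ : α → ℝ} (hτ : Measurable τ) :
    Measurable fun a => ∫⁻ x, g a x ∂polarMeasure n (τ a) := by
  have h : ∀ a, ∫⁻ x, g a x ∂polarMeasure n (τ a) = ENNReal.ofReal (τ a ^ (n - 1)) *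
      ∫⁻ ξ : Metric.sphere (0 : E) 1, g a (τ a • (ξ : E)) ∂(volume : Measure E).toSphere :=
    fun a => lintegral_polarMeasure (hg.comp measurable_prodMk_left) _
  simp_rw [h]
  refine Measurable.mul (by fun_prop) ?_
  refine Measurable.lintegral_prod_right'
    (f := fun q : α × Metric.sphere (0 : E) 1 => g q.1 (τ q.1 • (q.2 : E))) ?_
  exact hg.comp (f := fun q : α × Metric.sphere (0 : E) 1 => (q.1, τ q.1 • (q.2 : E)))
    (by fun_prop)

/-- Integration in polar coordinates. -/
theorem lintegral_eq_lintegral_polarMeasure (hn : 1 ≤ n) {g : E → ℝ≥0∞} (hg : Measurable g) :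
    ∫⁻ x, g x = ∫⁻ t in Ioi (0 : ℝ), ∫⁻ x, g x ∂polarMeasure n t := by
  have : Nonempty (Fin n) := ⟨⟨0, hn⟩⟩
  have hmp := (volume : Measure E).measurePreserving_homeomorphUnitSphereProd
  calc ∫⁻ x, g x = ∫⁻ x : ({(0)}ᶜ : Set E), g x ∂(volume.comap Subtype.val) := by
        rw [lintegral_subtype_comap (measurableSet_singleton _).compl g,
          restrict_compl_singleton]
    _ = ∫⁻ q, g (q.2.1 • (q.1 : E))
          ∂((volume : Measure E).toSphere.prod (.volumeIoiPow (Module.finrank ℝ E - 1))) := by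
        rw [← hmp.lintegral_comp_emb (Homeomorph.measurableEmbedding _)]
        refine lintegral_congr fun x => ?_
        have hx : ‖(x : E)‖ ≠ 0 := norm_ne_zero_iff.2 x.2
        simp [smul_smul, mul_inv_cancel₀ hx]
    _ = ∫⁻ t : Ioi (0 : ℝ), ∫⁻ ξ, g (t.1 • (ξ : E)) ∂(volume : Measure E).toSphere
          ∂(.volumeIoiPow (n - 1)) := by
        rw [finrank_euclideanSpace_fin, lintegral_prod_symm']
        exact hg.comp (by fun_prop)
    _ = _ := by
        rw [Measure.volumeIoiPow, lintegral_withDensity_eq_lintegral_mul _ (by fun_prop)]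
        · rw [← lintegral_subtype_comap measurableSet_Ioi]
          simp_rw [lintegral_polarMeasure hg]
          rfl
        · refine Measurable.lintegral_prod_right'
            (f := fun q : Ioi (0 : ℝ) × Metric.sphere (0 : E) 1 => g (q.1.1 • (q.2 : E))) ?_
          exact hg.comp (by fun_prop)

/-- Integration in polar coordinates over a spherical shell, as an upper bound by the integral over
the whole ball. -/
theorem setLIntegral_polarMeasure_le (hn : 1 ≤ n) {g : E → ℝ≥0∞} (hg : Measurable g)
    {r R : ℝ} (hr : 0 ≤ r) :
    ∫⁻ t in Ioo r R, ∫⁻ x, g x ∂polarMeasure n t ≤ ∫⁻ x in Metric.ball (0 : E) R, g x := by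
  rw [← lintegral_indicator Metric.isOpen_ball.measurableSet,
    lintegral_eq_lintegral_polarMeasure hn (hg.indicator Metric.isOpen_ball.measurableSet)]
  refine le_trans ?_ (lintegral_mono_set (s := Ioo r R) fun t ht => hr.trans_lt ht.1)
  refine setLIntegral_mono' measurableSet_Ioo fun t ht => ?_
  refine le_of_eq (lintegral_congr_ae ?_)
  filter_upwards [ae_polarMeasure_mem_sphere (n := n) (hr.trans ht.1.le)] with x hx
  rw [indicator_of_mem]
  rw [mem_sphere_zero_iff_norm] at hx
  simpa [hx] using ht.2

end Polar

/-! ### Hausdorff measure and cone measure on spheres -/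

/-- Comparison of the Hausdorff measure with a lower Ahlfors regular measure. Vitali's covering
theorem extracts from the small balls inside an open set a disjoint family whose fivefold
enlargements cover the set. -/
theorem hausdorffMeasure_le_of_le_measure_closedBall {X : Type*} [MetricSpace X]
    [MeasurableSpace X] [BorelSpace X] [SecondCountableTopology X] (ν : Measure X)
    [IsFiniteMeasure ν] {d : ℝ} (hd : 0 ≤ d) {c : ℝ≥0∞} (hc : c ≠ 0) (hc' : c ≠ ⊤)
    (h : ∀ x, ∀ ρ : ℝ, 0 < ρ → ρ ≤ 1 → c * ENNReal.ofReal ρ ^ d ≤ ν (Metric.closedBall x ρ)) :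
    μH[d] ≤ (10 ^ d / c) • ν := by
  have hopen : ∀ U : Set X, IsOpen U → μH[d] U ≤ 10 ^ d / c * ν U := by
    intro U hU
    -- At scale `1 / (k + 1)`, every point of `U` is the centre of an admissible ball.
    have hcov : ∀ k : ℕ, ∃ u : Set (X × ℝ), u.Countable ∧
        (∀ b ∈ u, 0 < b.2 ∧ b.2 ≤ 1 / ((k : ℝ) + 1) ∧ Metric.closedBall b.1 b.2 ⊆ U) ∧
        u.PairwiseDisjoint (fun b => Metric.closedBall b.1 b.2) ∧
        U ⊆ ⋃ b : u, Metric.closedBall b.1.1 (5 * b.1.2) := by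
      intro k
      have hk : (0 : ℝ) < 1 / ((k : ℝ) + 1) := by positivity
      obtain ⟨u, hut, hdisj, hu⟩ := Vitali.exists_disjoint_subfamily_covering_enlargement_closedBall
        {b : X × ℝ | 0 < b.2 ∧ b.2 ≤ 1 / ((k : ℝ) + 1) ∧ Metric.closedBall b.1 b.2 ⊆ U}
        Prod.fst Prod.snd (1 / ((k : ℝ) + 1)) (fun b hb => hb.2.1) 5 (by norm_num)
      refine ⟨u, ?_, fun b hb => hut hb, hdisj, ?_⟩
      · refine hdisj.countable_of_nonempty_interior fun b hb => ?_
        exact ⟨b.1, Metric.ball_subset_interior_closedBall (Metric.mem_ball_self (hut hb).1)⟩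
      · intro x hx
        obtain ⟨ρ, hρ, hρU⟩ := Metric.nhds_basis_closedBall.mem_iff.1 (hU.mem_nhds hx)
        obtain ⟨b, hb, hxb⟩ := hu (x, min ρ (1 / ((k : ℝ) + 1)))
          ⟨lt_min hρ hk, min_le_right _ _,
            (Metric.closedBall_subset_closedBall (min_le_left _ _)).trans hρU⟩
        exact mem_iUnion.2 ⟨⟨b, hb⟩, hxb (Metric.mem_closedBall_self (lt_min hρ hk).le)⟩
    choose u hucount hu hdisj hUu using hcov
    have : ∀ k, Countable (u k) := fun k => (hucount k).to_subtype
    have hdiam : ∀ k, ∀ b : u k, Metric.ediam (Metric.closedBall b.1.1 (5 * b.1.2)) ≤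
        10 * ENNReal.ofReal b.1.2 := by
      intro k b
      have hb := (hu k b.1 b.2).1
      rw [← Metric.closedEBall_ofReal (by linarith)]
      refine Metric.ediam_closedEBall_le.trans (le_of_eq ?_)
      rw [ENNReal.ofReal_mul (by norm_num), ← mul_assoc]
      norm_num
    have hlim : Tendsto (fun k : ℕ => 10 * ENNReal.ofReal (1 / ((k : ℝ) + 1))) atTop (𝓝 0) := by
      have := ENNReal.tendsto_ofReal (tendsto_one_div_add_atTop_nhds_zero_nat (𝕜 := ℝ))
      simpa using ENNReal.Tendsto.const_mul this (Or.inr (by simp : (10 : ℝ≥0∞) ≠ ⊤))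
    refine (Measure.hausdorffMeasure_le_liminf_tsum d U (l := atTop) _ hlim
      (fun k (b : u k) => Metric.closedBall b.1.1 (5 * b.1.2)) ?_ (.of_forall hUu)).trans ?_
    · refine .of_forall fun k b => (hdiam k b).trans ?_
      gcongr
      exact (hu k b.1 b.2).2.1
    · refine liminf_le_of_frequently_le' (Frequently.of_forall fun k => ?_)
      calc ∑' b : u k, Metric.ediam (Metric.closedBall b.1.1 (5 * b.1.2)) ^ d
          ≤ ∑' b : u k, 10 ^ d / c * ν (Metric.closedBall b.1.1 b.1.2) := by
            refine ENNReal.tsum_le_tsum fun b => ?_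
            obtain ⟨hb0, hb1, hbU⟩ := hu k b.1 b.2
            have hb1' : b.1.2 ≤ 1 := hb1.trans (by
              rw [div_le_one (by positivity)]; linarith [(Nat.cast_nonneg k : (0 : ℝ) ≤ k)])
            calc Metric.ediam (Metric.closedBall b.1.1 (5 * b.1.2)) ^ d
                ≤ (10 * ENNReal.ofReal b.1.2) ^ d := by gcongr; exact hdiam k b
              _ = 10 ^ d / c * (c * ENNReal.ofReal b.1.2 ^ d) := by
                  rw [ENNReal.mul_rpow_of_nonneg _ _ hd, ← mul_assoc,
                    ENNReal.div_mul_cancel hc hc']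
              _ ≤ _ := by gcongr; exact h _ _ hb0 hb1'
        _ = 10 ^ d / c * ν (⋃ b : u k, Metric.closedBall b.1.1 b.1.2) := by
            rw [ENNReal.tsum_mul_left, measure_iUnion]
            · exact fun a b hab => hdisj k a.2 b.2 (Subtype.coe_injective.ne hab)
            · exact fun b => Metric.isClosed_closedBall.measurableSet
        _ ≤ 10 ^ d / c * ν U := by
            gcongr
            exact iUnion_subset fun b => (hu k b.1 b.2).2.2
  refine Measure.le_iff.2 fun s hs => ?_
  rw [Measure.smul_apply, smul_eq_mul]
  have hK : (10 ^ d / c : ℝ≥0∞) ≠ ⊤ :=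
    ENNReal.div_ne_top (ENNReal.rpow_ne_top_of_nonneg hd (by simp)) hc
  have hK0 : (10 ^ d / c : ℝ≥0∞) ≠ 0 := by
    simp [ENNReal.div_eq_zero_iff, hc', ENNReal.rpow_eq_zero_iff]
  rw [s.measure_eq_iInf_isOpen ν]
  simp_rw [ENNReal.mul_iInf_of_ne hK0 hK]
  exact le_iInf₂ fun U hsU => le_iInf fun hU => (measure_mono hsU).trans (hopen U hU)

section Sphere

variable {n : ℕ}

local notation "E" => EuclideanSpace ℝ (Fin n)

/-- The cone measure of a spherical cap of radius `ρ` is at least a multiple of `ρ ^ (n - 1)`,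
because the sector of height `ρ` over the cap contains a ball of radius `ρ / 4`. -/
theorem le_toSphere_closedBall (hn : 1 ≤ n) (x : Metric.sphere (0 : E) 1) {ρ : ℝ} (hρ : 0 < ρ)
    (hρ1 : ρ ≤ 1) :
    ENNReal.ofReal (1 / 4) ^ n * volume (Metric.ball (0 : E) 1) *
      ENNReal.ofReal ρ ^ ((n - 1 : ℕ) : ℝ) ≤
      (volume : Measure E).toSphere (Metric.closedBall x ρ) := by
  set A := Metric.closedBall x ρ
  set B := Metric.ball ((1 - ρ / 4) • (x : E)) (ρ / 4)
  have hxn : ‖(x : E)‖ = 1 := by simp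
  have hB : MeasurableSet B := Metric.isOpen_ball.measurableSet
  -- In polar coordinates, the ball `B` lies over the cap `A`, at heights in `(1 - ρ, 1)`.
  have key : ∀ t > (0 : ℝ), ∀ ξ : Metric.sphere (0 : E) 1, t • (ξ : E) ∈ B →
      t ∈ Ioo (1 - ρ) 1 ∧ ξ ∈ A := by
    intro t ht ξ hξ
    have hξn : ‖(ξ : E)‖ = 1 := by simp
    rw [Metric.mem_ball, dist_eq_norm] at hξ
    have h1 : ‖(1 - ρ / 4) • (x : E)‖ = 1 - ρ / 4 := by
      rw [norm_smul, hxn, Real.norm_of_nonneg (by linarith), mul_one]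
    have h2 : ‖t • (ξ : E)‖ = t := by
      rw [norm_smul, hξn, Real.norm_of_nonneg ht.le, mul_one]
    have h3 := abs_norm_sub_norm_le (t • (ξ : E)) ((1 - ρ / 4) • (x : E))
    rw [h1, h2] at h3
    have h4 := abs_lt.1 (h3.trans_lt hξ)
    refine ⟨⟨by linarith, by linarith⟩, ?_⟩
    rw [Metric.mem_closedBall, Subtype.dist_eq, dist_eq_norm]
    have e : (ξ : E) - x = (1 - t) • (ξ : E) + (t • (ξ : E) - (1 - ρ / 4) • (x : E))
        + (-(ρ / 4)) • (x : E) := by module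
    rw [e]
    refine (norm_add₃_le).trans ?_
    rw [norm_smul, norm_smul, hξn, hxn, Real.norm_of_nonneg (by linarith), norm_neg,
      Real.norm_of_nonneg (by linarith)]
    linarith
  have hvol : volume B ≤ ENNReal.ofReal ρ * (volume : Measure E).toSphere A := by
    rw [← lintegral_indicator_one hB,
      lintegral_eq_lintegral_polarMeasure hn (measurable_one.indicator hB)]
    calc ∫⁻ t in Ioi (0 : ℝ), ∫⁻ y, B.indicator 1 y ∂polarMeasure n t
        ≤ ∫⁻ t in Ioi (0 : ℝ), (Ioo (1 - ρ) 1).indicator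
            (fun _ => (volume : Measure E).toSphere A) t := by
          refine setLIntegral_mono' measurableSet_Ioi fun t ht => ?_
          rw [lintegral_polarMeasure (measurable_one.indicator hB)]
          by_cases htI : t ∈ Ioo (1 - ρ) 1
          · rw [indicator_of_mem htI]
            have ht1 : ENNReal.ofReal (t ^ (n - 1)) ≤ 1 :=
              ENNReal.ofReal_le_one.2 (pow_le_one₀ (le_of_lt ht) htI.2.le)
            refine (mul_le_of_le_one_left' ht1).trans ?_
            rw [← lintegral_indicator_one Metric.isClosed_closedBall.measurableSet]
            refine lintegral_mono fun ξ => ?_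
            by_cases hξ : t • (ξ : E) ∈ B
            · rw [indicator_of_mem hξ, indicator_of_mem (key t ht ξ hξ).2]; simp
            · rw [indicator_of_notMem hξ]; exact zero_le
          · have : ∀ ξ : Metric.sphere (0 : E) 1,
                B.indicator (1 : E → ℝ≥0∞) (t • (ξ : E)) = 0 := fun ξ =>
              indicator_of_notMem (fun hξ => htI (key t ht ξ hξ).1) _
            simp [this]
      _ ≤ ∫⁻ t, (Ioo (1 - ρ) 1).indicator
            (fun _ => (volume : Measure E).toSphere A) t := setLIntegral_le_lintegral _ _
      _ = _ := by
          rw [lintegral_indicator measurableSet_Ioo, setLIntegral_const, Real.volume_Ioo, mul_comm]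
          congr 2; ring
  rw [Measure.addHaar_ball_of_pos _ _ (by positivity), finrank_euclideanSpace_fin] at hvol
  have hρ0 : ENNReal.ofReal ρ ≠ 0 := by simpa using hρ
  rw [← ENNReal.mul_le_mul_iff_right hρ0 ENNReal.ofReal_ne_top]
  refine le_trans (le_of_eq ?_) hvol
  rw [ENNReal.rpow_natCast]
  obtain ⟨k, rfl⟩ : ∃ k, n = k + 1 := ⟨n - 1, by omega⟩
  rw [← ENNReal.ofReal_pow (by positivity), ← ENNReal.ofReal_pow (by positivity)]
  have : ENNReal.ofReal ((ρ / 4) ^ (k + 1)) = ENNReal.ofReal ρ * ENNReal.ofReal (ρ ^ k) *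
      ENNReal.ofReal ((1 / 4) ^ (k + 1)) := by
    rw [← ENNReal.ofReal_mul (by positivity), ← ENNReal.ofReal_mul (by positivity)]
    congr 1
    rw [div_eq_mul_one_div ρ 4, mul_pow, pow_succ ρ]
    ring
  rw [this, Nat.add_sub_cancel]
  ring

open scoped Pointwise in
/-- The Hausdorff measure on spheres is dominated by a multiple of the cone measure. -/
theorem exists_sphereMeasure_le_smul_polarMeasure (hn : 1 ≤ n) :
    ∃ K : ℝ≥0∞, K ≠ ⊤ ∧ ∀ t : ℝ, 0 < t → sphereMeasure n t ≤ K • polarMeasure n t := by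
  have : Nonempty (Fin n) := ⟨⟨0, hn⟩⟩
  set c : ℝ≥0∞ := ENNReal.ofReal (1 / 4) ^ n * volume (Metric.ball (0 : E) 1)
  have hc : c ≠ 0 := mul_ne_zero (pow_ne_zero _ (by simp)) (Metric.measure_ball_pos _ _ one_pos).ne'
  have hc' : c ≠ ⊤ := ENNReal.mul_ne_top (ENNReal.pow_ne_top ENNReal.ofReal_ne_top)
    measure_ball_lt_top.ne
  have hle := hausdorffMeasure_le_of_le_measure_closedBall (volume : Measure E).toSphere
    (Nat.cast_nonneg (n - 1)) hc hc' fun x ρ h0 h1 => le_toSphere_closedBall hn x h0 h1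
  obtain ⟨κ, hκ⟩ : ∃ κ : NNReal, ∀ A : Set (Metric.sphere (0 : E) 1),
      μHE[n - 1] A = κ * μH[((n - 1 : ℕ) : ℝ)] A := ⟨_, fun A => rfl⟩
  refine ⟨κ * (10 ^ ((n - 1 : ℕ) : ℝ) / c), ENNReal.mul_ne_top ENNReal.coe_ne_top
    (ENNReal.div_ne_top (ENNReal.rpow_ne_top_of_nonneg (Nat.cast_nonneg _) (by simp)) hc), ?_⟩
  intro t ht
  refine Measure.le_iff.2 fun S hS => ?_
  set A : Set (Metric.sphere (0 : E) 1) := {ξ | t • (ξ : E) ∈ S}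
  have hA : S ∩ Metric.sphere 0 t = t • (Subtype.val '' A) := by
    ext x
    rw [Set.mem_smul_set_iff_inv_smul_mem₀ ht.ne']
    constructor
    · rintro ⟨hxS, hxt⟩
      rw [mem_sphere_zero_iff_norm] at hxt
      refine ⟨⟨t⁻¹ • x, ?_⟩, ?_, rfl⟩
      · rw [mem_sphere_zero_iff_norm, norm_smul, hxt, norm_inv, Real.norm_of_nonneg ht.le,
          inv_mul_cancel₀ ht.ne']
      · simpa [A, smul_smul, mul_inv_cancel₀ ht.ne'] using hxS
    · rintro ⟨ξ, hξ, hξx⟩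
      obtain rfl : x = t • (ξ : E) := by rw [hξx, smul_smul, mul_inv_cancel₀ ht.ne', one_smul]
      exact ⟨hξ, by simp [norm_smul, abs_of_pos ht]⟩
  rw [sphereMeasure, Measure.restrict_apply hS, hA,
    Measure.euclideanHausdorffMeasure_smul₀ _ ht.ne',
    Isometry.euclideanHausdorffMeasure_image isometry_subtype_coe, hκ]
  rw [Measure.smul_apply, polarMeasure, Measure.smul_apply, Measure.map_apply (by fun_prop) hS]
  have hnorm : ((‖t‖₊ ^ (n - 1) : NNReal) : ℝ≥0∞) = ENNReal.ofReal (t ^ (n - 1)) := by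
    rw [ENNReal.coe_pow, ← enorm_eq_nnnorm, Real.enorm_of_nonneg ht.le, ENNReal.ofReal_pow ht.le]
  rw [ENNReal.smul_def, hnorm, smul_eq_mul, smul_eq_mul, smul_eq_mul]
  calc ENNReal.ofReal (t ^ (n - 1)) * (κ * μH[((n - 1 : ℕ) : ℝ)] A)
      ≤ ENNReal.ofReal (t ^ (n - 1)) *
          (κ * (10 ^ ((n - 1 : ℕ) : ℝ) / c * (volume : Measure E).toSphere A)) := by
        gcongr
        exact hle A
    _ = _ := by
        rw [mul_left_comm, mul_left_comm (ENNReal.ofReal _), ← mul_assoc]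
        rfl

end Sphere

/-! ### The singular kernel on a sphere -/

section Kernel

variable {n : ℕ}

local notation "E" => EuclideanSpace ℝ (Fin n)

theorem setLIntegral_enorm_rpow_neg_lt_top {a : ℝ} (ha : n < a) :
    ∫⁻ w in {w : E | 1 ≤ ‖w‖}, ‖w‖ₑ ^ (-a) < ⊤ := by
  have ha0 : 0 < a := (Nat.cast_nonneg n).trans_lt ha
  have hfin : ∫⁻ x : E, ENNReal.ofReal ((1 + ‖x‖) ^ (-a)) < ⊤ :=
    finite_integral_one_add_norm (by simpa using ha)
  refine lt_of_le_of_lt ?_ (ENNReal.mul_lt_top (a := ENNReal.ofReal (2 ^ a)) ENNReal.ofReal_lt_top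
    hfin)
  rw [← lintegral_const_mul' _ _ ENNReal.ofReal_ne_top]
  refine (setLIntegral_mono' (measurableSet_le measurable_const measurable_norm)
    fun w hw => ?_).trans (setLIntegral_le_lintegral _ _)
  have hw1 : 1 ≤ ‖w‖ := hw
  rw [← ENNReal.ofReal_mul (by positivity), ← ofReal_norm,
    ENNReal.ofReal_rpow_of_pos (by linarith)]
  refine ENNReal.ofReal_le_ofReal ?_
  rw [Real.rpow_neg (by positivity), Real.rpow_neg (by positivity), ← div_eq_mul_inv,
    inv_eq_one_div, div_le_div_iff₀ (by positivity) (by positivity), one_mul,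
    ← Real.mul_rpow (by norm_num) (by positivity)]
  exact Real.rpow_le_rpow (by positivity) (by linarith) ha0.le

/-- Scaling of the integral of a power of the distance over the complement of a ball. -/
theorem setLIntegral_edist_rpow_neg (x : E) {q : ℝ} (hq : 0 < q) (a : ℝ) :
    ∫⁻ w in {w : E | q ≤ dist x w}, edist x w ^ (-a) =
      ENNReal.ofReal q ^ ((n : ℝ) - a) * ∫⁻ w in {w : E | 1 ≤ ‖w‖}, ‖w‖ₑ ^ (-a) := by
  have hq0 : ENNReal.ofReal q ≠ 0 := by simpa using hq
  have hms : MeasurableSet {w : E | 1 ≤ ‖w‖} := measurableSet_le measurable_const measurable_norm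
  have hms' : MeasurableSet {w : E | q ≤ dist x w} :=
    measurableSet_le measurable_const (by fun_prop)
  set g : E → ℝ≥0∞ := {w : E | q ≤ dist x w}.indicator fun w => edist x w ^ (-a)
  have hg : Measurable g := Measurable.indicator (by fun_prop) hms'
  have hscale : ∀ w, g (q • w + x) = ENNReal.ofReal q ^ (-a) *
      {w : E | 1 ≤ ‖w‖}.indicator (fun w => ‖w‖ₑ ^ (-a)) w := by
    intro w
    have hd : dist x (q • w + x) = q * ‖w‖ := by
      rw [dist_comm, dist_eq_norm, add_sub_cancel_right, norm_smul, Real.norm_of_nonneg hq.le]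
    have hed : edist x (q • w + x) = ENNReal.ofReal q * ‖w‖ₑ := by
      rw [edist_dist, hd, ENNReal.ofReal_mul hq.le, ofReal_norm]
    by_cases hw : 1 ≤ ‖w‖
    · have h1 : q * 1 ≤ q * ‖w‖ := by gcongr
      simp only [g]
      rw [indicator_of_mem (by simpa [hd] using h1), indicator_of_mem (by exact hw), hed,
        ENNReal.mul_rpow_of_ne_top ENNReal.ofReal_ne_top enorm_ne_top]
    · have h1 : ¬ q ≤ q * ‖w‖ := by
        push Not at hw ⊢
        nlinarith
      simp only [g]
      rw [indicator_of_notMem (by simpa [hd] using h1), indicator_of_notMem (by exact hw), mul_zero]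
  rw [← lintegral_indicator hms', ← lintegral_indicator hms]
  have h1 : ∫⁻ w, g (q • w + x) = ENNReal.ofReal (q ^ n)⁻¹ * ∫⁻ w, g w := by
    rw [← lintegral_add_right_eq_self g x,
      ← lintegral_map (f := fun w => g (w + x)) (hg.comp (measurable_add_const x))
        (measurable_const_smul q), Measure.map_addHaar_smul _ hq.ne', lintegral_smul_measure,
      finrank_euclideanSpace_fin, abs_of_pos (by positivity), smul_eq_mul]
  simp_rw [hscale] at h1
  rw [lintegral_const_mul' _ _ (by simp [ENNReal.rpow_eq_top_iff, hq])] at h1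
  rw [sub_eq_add_neg, ENNReal.rpow_add _ _ hq0 ENNReal.ofReal_ne_top, mul_assoc, h1, ← mul_assoc,
    ENNReal.rpow_natCast, ← ENNReal.ofReal_pow hq.le, ← ENNReal.ofReal_mul (by positivity),
    mul_inv_cancel₀ (by positivity), ENNReal.ofReal_one, one_mul]

/-- The tail of the singular kernel on a sphere. The tail integral over the sphere of radius `t` is
comparable with the one over each concentric sphere of radius `τ ∈ (t, t + ρ / 2)`; averaging in
`τ` bounds it by an integral over the complement of a ball in `ℝⁿ`. -/
theorem exists_setLIntegral_polarMeasure_edist_rpow_neg_le (hn : 1 ≤ n) {b : ℝ} (hb : 0 < b) :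
    ∃ C : ℝ≥0∞, C ≠ ⊤ ∧ ∀ (t ρ : ℝ) (x : E), 0 < t → 0 < ρ →
      ∫⁻ y in {y : E | ρ ≤ dist x y}, edist x y ^ (-((n : ℝ) - 1 + b + n)) ∂polarMeasure n t ≤
        C * ENNReal.ofReal ρ ^ (-(n + b)) := by
  have hn' : (1 : ℝ) ≤ n := by exact_mod_cast hn
  set a : ℝ := (n : ℝ) - 1 + b + n with ha_def
  have ha : (n : ℝ) < a := by linarith
  have ha0 : 0 < a := by linarith
  set c : ℝ≥0∞ := ∫⁻ w in {w : E | 1 ≤ ‖w‖}, ‖w‖ₑ ^ (-a)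
  have hc : c ≠ ⊤ := (setLIntegral_enorm_rpow_neg_lt_top ha).ne
  refine ⟨2 ^ a * c * 2 ^ (n + b), ENNReal.mul_ne_top (ENNReal.mul_ne_top
    (ENNReal.rpow_ne_top_of_nonneg ha0.le (by simp)) hc)
    (ENNReal.rpow_ne_top_of_nonneg (by linarith) (by simp)), fun t ρ x ht hρ => ?_⟩
  have hms : ∀ q : ℝ, MeasurableSet {w : E | q ≤ dist x w} := fun q =>
    measurableSet_le measurable_const (by fun_prop)
  set g : ℝ → E → ℝ≥0∞ := fun q => {w : E | q ≤ dist x w}.indicator fun w => edist x w ^ (-a)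
  have hg : ∀ q, Measurable (g q) := fun q => Measurable.indicator (by fun_prop) (hms q)
  rw [← lintegral_indicator (hms ρ)]
  change ∫⁻ y, g ρ y ∂polarMeasure n t ≤ _
  -- Moving `y` radially by less than `ρ / 2` changes `|x - y| ≥ ρ` by a factor in `[1/2, 3/2]`.
  have hmono : ∀ τ ∈ Ioo t (t + ρ / 2), ∫⁻ y, g ρ y ∂polarMeasure n t ≤
      2 ^ a * ∫⁻ y, g (ρ / 2) y ∂polarMeasure n τ := by
    intro τ hτ
    rw [lintegral_polarMeasure (hg _), lintegral_polarMeasure (hg _), mul_left_comm,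
      ← lintegral_const_mul' _ _ (ENNReal.rpow_ne_top_of_nonneg ha0.le (by simp))]
    gcongr with ξ
    · exact hτ.1.le
    · have hd : dist (t • (ξ : E)) (τ • (ξ : E)) ≤ ρ / 2 := by
        rw [dist_eq_norm, ← sub_smul, norm_smul, mem_sphere_zero_iff_norm.1 ξ.2, mul_one,
          Real.norm_eq_abs, abs_le]
        constructor <;> linarith [hτ.1, hτ.2]
      by_cases hξ : ρ ≤ dist x (t • (ξ : E))
      · have h1 := dist_triangle x (τ • (ξ : E)) (t • (ξ : E))
        have h2 := dist_triangle x (t • (ξ : E)) (τ • (ξ : E))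
        rw [dist_comm (τ • (ξ : E))] at h1
        simp only [g]
        rw [indicator_of_mem (by exact hξ), indicator_of_mem (by change ρ / 2 ≤ _; linarith)]
        have h3 : edist x (τ • (ξ : E)) ≤ 2 * edist x (t • (ξ : E)) := by
          have h5 := ENNReal.ofReal_le_ofReal
            (show dist x (τ • (ξ : E)) ≤ 2 * dist x (t • (ξ : E)) by linarith)
          rwa [ENNReal.ofReal_mul (by norm_num), ENNReal.ofReal_ofNat, ← edist_dist,
            ← edist_dist] at h5
        have h4 : (2 * edist x (t • (ξ : E))) ^ (-a) ≤ edist x (τ • (ξ : E)) ^ (-a) := by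
          rw [ENNReal.rpow_neg, ENNReal.rpow_neg]
          gcongr
        rw [ENNReal.mul_rpow_of_ne_top (by simp) (edist_ne_top _ _)] at h4
        calc edist x (t • (ξ : E)) ^ (-a)
            = 2 ^ a * (2 ^ (-a) * edist x (t • (ξ : E)) ^ (-a)) := by
              rw [← mul_assoc, ← ENNReal.rpow_add _ _ (by simp) (by simp)]
              simp
          _ ≤ _ := by gcongr
      · simp only [g]
        rw [indicator_of_notMem (by exact hξ)]
        exact zero_le
  have hq : 0 < ρ / 2 := by positivity
  have hq0 : ENNReal.ofReal (ρ / 2) ≠ 0 := by simpa using hρ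
  have h2a : (2 ^ a : ℝ≥0∞) ≠ ⊤ := ENNReal.rpow_ne_top_of_nonneg ha0.le (by simp)
  have hint : ENNReal.ofReal (ρ / 2) * ∫⁻ y, g ρ y ∂polarMeasure n t ≤
      2 ^ a * (ENNReal.ofReal (ρ / 2) ^ ((n : ℝ) - a) * c) := by
    calc ENNReal.ofReal (ρ / 2) * ∫⁻ y, g ρ y ∂polarMeasure n t
        = ∫⁻ τ in Ioo t (t + ρ / 2), ∫⁻ y, g ρ y ∂polarMeasure n t := by
          rw [setLIntegral_const, Real.volume_Ioo, add_sub_cancel_left, mul_comm]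
      _ ≤ ∫⁻ τ in Ioo t (t + ρ / 2), 2 ^ a * ∫⁻ y, g (ρ / 2) y ∂polarMeasure n τ :=
          setLIntegral_mono' measurableSet_Ioo hmono
      _ = 2 ^ a * ∫⁻ τ in Ioo t (t + ρ / 2), ∫⁻ y, g (ρ / 2) y ∂polarMeasure n τ :=
          lintegral_const_mul' _ _ h2a
      _ ≤ 2 ^ a * ∫⁻ w, g (ρ / 2) w := by
          gcongr
          exact (setLIntegral_polarMeasure_le hn (hg _) ht.le).trans (setLIntegral_le_lintegral _ _)
      _ = _ := by
          rw [lintegral_indicator (hms _), setLIntegral_edist_rpow_neg x hq]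
  rw [← ENNReal.mul_le_mul_iff_right hq0 ENNReal.ofReal_ne_top]
  refine hint.trans (le_of_eq ?_)
  have e1 : ENNReal.ofReal ρ = 2 * ENNReal.ofReal (ρ / 2) := by
    rw [← ENNReal.ofReal_ofNat, ← ENNReal.ofReal_mul (by norm_num)]
    congr 1; ring
  have e2 : (n : ℝ) - a = 1 + -(n + b) := by rw [ha_def]; ring
  rw [e1, ENNReal.mul_rpow_of_ne_top (by simp) ENNReal.ofReal_ne_top, e2,
    ENNReal.rpow_add _ _ hq0 ENNReal.ofReal_ne_top, ENNReal.rpow_one]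
  have e3 : (2 : ℝ≥0∞) ^ (n + b) * 2 ^ (-(n + b)) = 1 := by
    rw [← ENNReal.rpow_add _ _ (by simp) (by simp)]; simp
  calc _ = 2 ^ a * c * (ENNReal.ofReal (ρ / 2) * ENNReal.ofReal (ρ / 2) ^ (-(n + b))) * 1 := by
        ring
    _ = _ := by rw [← e3]; ring

end Kernel

/-! ### The Gagliardo energy on a sphere -/

/-- The density `x ↦ ∫_{B_R} |f(x) - f(y)|^p / |x - y|^{n + sp} dy` of the Gagliardo energy. -/
noncomputable def gagliardoDensity {n m : ℕ} (s p R : ℝ)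
    (f : EuclideanSpace ℝ (Fin n) → EuclideanSpace ℝ (Fin m)) (x : EuclideanSpace ℝ (Fin n)) :
    ℝ≥0∞ :=
  ∫⁻ y in Metric.ball (0 : EuclideanSpace ℝ (Fin n)) R,
    ‖f x - f y‖ₑ ^ p / edist x y ^ ((n : ℝ) + s * p)

/-- The energy `∫ |f(x) - f(z)|^p dz` over those `z ∈ B_R` with `|x - z| ≤ 2 |x - y|`. -/
noncomputable def nearEnergy {n m : ℕ} (p R : ℝ)
    (f : EuclideanSpace ℝ (Fin n) → EuclideanSpace ℝ (Fin m)) (x y : EuclideanSpace ℝ (Fin n)) :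
    ℝ≥0∞ :=
  ∫⁻ z in Metric.ball (0 : EuclideanSpace ℝ (Fin n)) R,
    {z | edist x z ≤ 2 * edist x y}.indicator (fun z => ‖f x - f z‖ₑ ^ p) z

section Energy

variable {n m : ℕ} {f : EuclideanSpace ℝ (Fin n) → EuclideanSpace ℝ (Fin m)} {s p R t : ℝ}

local notation "E" => EuclideanSpace ℝ (Fin n)

theorem gagliardoBall_rpow (hp : 0 < p) :
    gagliardoBall s p R f ^ p = ∫⁻ x in Metric.ball (0 : E) R, gagliardoDensity s p R f x := by
  rw [gagliardoBall, ← ENNReal.rpow_mul, one_div, inv_mul_cancel₀ hp.ne', ENNReal.rpow_one]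
  rfl

theorem measurable_gagliardoDensity (hf : Measurable f) :
    Measurable (gagliardoDensity s p R f) := by
  refine Measurable.lintegral_prod_right'
    (f := fun q : E × E => ‖f q.1 - f q.2‖ₑ ^ p / edist q.1 q.2 ^ ((n : ℝ) + s * p)) ?_
  fun_prop

theorem measurable_nearEnergy_integrand (hf : Measurable f) :
    Measurable fun q : (E × E) × E => {z | edist q.1.1 z ≤ 2 * edist q.1.1 q.1.2}.indicator
      (fun z => ‖f q.1.1 - f z‖ₑ ^ p) q.2 := by
  have hS : MeasurableSet {q : (E × E) × E | edist q.1.1 q.2 ≤ 2 * edist q.1.1 q.1.2} :=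
    measurableSet_le (by fun_prop) (by fun_prop)
  exact (Measurable.indicator
    (f := fun q : (E × E) × E => ‖f q.1.1 - f q.2‖ₑ ^ p) (by fun_prop) hS)

theorem measurable_nearEnergy (hf : Measurable f) :
    Measurable (Function.uncurry (nearEnergy p R f)) :=
  Measurable.lintegral_prod_right' (measurable_nearEnergy_integrand hf)

/-- The oscillation between two points `x`, `y` of a sphere inside `B_R` is controlled by comparing
with the values on the ball of radius `|x - y| / 4` touching the sphere at `x` from inside. -/
theorem enorm_sub_rpow_mul_le_nearEnergy (hf : Measurable f) (hp : 1 ≤ p) (ht : 0 < t)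
    (htR : t < R) {x y : E} (hx : x ∈ Metric.sphere (0 : E) t) (hy : y ∈ Metric.sphere (0 : E) t) :
    ‖f x - f y‖ₑ ^ p * edist x y ^ (n : ℝ) * volume (Metric.ball (0 : E) (1 / 4)) ≤
      2 ^ (p - 1) * (nearEnergy p R f x y + nearEnergy p R f y x) := by
  have hp0 : 0 < p := by linarith
  rw [mem_sphere_zero_iff_norm] at hx hy
  rcases eq_or_ne x y with rfl | hxy
  · simp [hp0]
  set d := dist x y with hd_def
  have hd : 0 < d := dist_pos.2 hxy
  have hd2 : d ≤ 2 * t := by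
    rw [hd_def, dist_eq_norm]
    linarith [norm_sub_le x y]
  -- The centre is moved inwards by `d / 4`, so the ball of radius `d / 4` stays in `B_t ⊆ B_R`.
  set c : E := (1 - d / (4 * t)) • x
  have hcoef : d / (4 * t) ≤ 1 / 2 := by rw [div_le_iff₀ (by positivity)]; linarith
  have hcoef0 : 0 ≤ d / (4 * t) := by positivity
  have hdt : d / (4 * t) * t = d / 4 := by field_simp
  have hcx : dist c x = d / 4 := by
    rw [dist_eq_norm, show c - x = -((d / (4 * t)) • x) by simp only [c]; module, norm_neg,
      norm_smul, hx, Real.norm_of_nonneg hcoef0, hdt]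
  have hc : ‖c‖ = t - d / 4 := by
    rw [norm_smul, hx, Real.norm_of_nonneg (by linarith), sub_mul, hdt, one_mul]
  set D := Metric.ball c (d / 4)
  have hDm : MeasurableSet D := Metric.isOpen_ball.measurableSet
  have hDR : D ⊆ Metric.ball 0 R := by
    intro z hz
    rw [Metric.mem_ball] at hz
    rw [mem_ball_zero_iff]
    have := norm_le_norm_add_norm_sub c z
    rw [← dist_eq_norm, dist_comm] at this
    linarith
  have hle : ∀ {u v u' v' : E}, dist u v ≤ 2 * dist u' v' → edist u v ≤ 2 * edist u' v' := by
    intro u v u' v' h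
    have h5 := ENNReal.ofReal_le_ofReal h
    rwa [ENNReal.ofReal_mul (by norm_num), ENNReal.ofReal_ofNat, ← edist_dist,
      ← edist_dist] at h5
  have hDx : ∀ z ∈ D, edist x z ≤ 2 * edist x y := by
    intro z hz
    rw [Metric.mem_ball] at hz
    refine hle ?_
    rw [← hd_def, dist_comm]
    linarith [dist_triangle z c x]
  have hDy : ∀ z ∈ D, edist y z ≤ 2 * edist y x := by
    intro z hz
    rw [Metric.mem_ball] at hz
    refine hle ?_
    rw [dist_comm y x, ← hd_def, dist_comm]
    linarith [dist_triangle z c y, dist_triangle c x y]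
  have hvol : volume D = edist x y ^ (n : ℝ) * volume (Metric.ball (0 : E) (1 / 4)) := by
    rw [Measure.addHaar_ball_of_pos _ _ (by positivity),
      Measure.addHaar_ball_of_pos _ (0 : E) (r := 1 / 4) (by norm_num), ENNReal.rpow_natCast,
      edist_dist, ← hd_def, ← ENNReal.ofReal_pow hd.le, ← mul_assoc,
      ← ENNReal.ofReal_mul (by positivity), finrank_euclideanSpace_fin, ← mul_pow,
      mul_one_div]
  have hnear : ∀ u v : E, (∀ z ∈ D, edist u z ≤ 2 * edist u v) →
      ∫⁻ z in D, ‖f u - f z‖ₑ ^ p ≤ nearEnergy p R f u v := by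
    intro u v h
    refine le_trans ?_ (lintegral_mono_set hDR)
    refine setLIntegral_mono' hDm fun z hz => ?_
    rw [indicator_of_mem]
    exact h z hz
  calc ‖f x - f y‖ₑ ^ p * edist x y ^ (n : ℝ) * volume (Metric.ball (0 : E) (1 / 4))
      = ∫⁻ z in D, ‖f x - f y‖ₑ ^ p := by rw [setLIntegral_const, hvol, mul_assoc]
    _ ≤ ∫⁻ z in D, 2 ^ (p - 1) * (‖f x - f z‖ₑ ^ p + ‖f y - f z‖ₑ ^ p) := by
        refine lintegral_mono fun z => ?_
        refine le_trans ?_ (ENNReal.rpow_add_le_mul_rpow_add_rpow _ _ hp)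
        gcongr
        rw [show f x - f y = (f x - f z) - (f y - f z) by abel]
        exact enorm_sub_le
    _ = 2 ^ (p - 1) * ((∫⁻ z in D, ‖f x - f z‖ₑ ^ p) + ∫⁻ z in D, ‖f y - f z‖ₑ ^ p) := by
        rw [lintegral_const_mul' _ _ (ENNReal.rpow_ne_top_of_nonneg (by linarith) (by simp)),
          lintegral_add_left (by fun_prop)]
    _ ≤ _ := by
        gcongr
        · exact hnear x y hDx
        · exact hnear y x hDy

/-- The Gagliardo energy on the sphere `∂B_t` is bounded by the spherical integral of the Gagliardo
density over `B_R`, for each single `t < R`. -/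
theorem exists_lintegral_polarMeasure_gagliardo_le (hn : 1 ≤ n) (hs : 0 < s) (hp : 1 ≤ p) :
    ∃ C : ℝ≥0∞, C ≠ ⊤ ∧ ∀ (m : ℕ) (f : E → EuclideanSpace ℝ (Fin m)), Measurable f →
      ∀ t R : ℝ, 0 < t → t < R →
        ∫⁻ x, ∫⁻ y, ‖f x - f y‖ₑ ^ p / edist x y ^ ((n : ℝ) - 1 + s * p) ∂polarMeasure n t
          ∂polarMeasure n t ≤ C * ∫⁻ x, gagliardoDensity s p R f x ∂polarMeasure n t := by
  have hp0 : 0 < p := by linarith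
  have hb : 0 < s * p := by positivity
  have hn' : (1 : ℝ) ≤ n := by exact_mod_cast hn
  obtain ⟨C₁, hC₁, hker⟩ := exists_setLIntegral_polarMeasure_edist_rpow_neg_le hn hb
  set a : ℝ := (n : ℝ) - 1 + s * p + n with ha_def
  have ha0 : 0 < a := by linarith
  set v := volume (Metric.ball (0 : E) (1 / 4))
  have hv : v ≠ 0 := (Metric.measure_ball_pos _ _ (by norm_num)).ne'
  have hv' : v ≠ ⊤ := measure_ball_lt_top.ne
  set C₀ : ℝ≥0∞ := 2 ^ (p - 1) / v
  have hC₀ : C₀ ≠ ⊤ :=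
    ENNReal.div_ne_top (ENNReal.rpow_ne_top_of_nonneg (by linarith) (by simp)) hv
  set C₂ : ℝ≥0∞ := C₁ * 2 ^ (n + s * p)
  have hC₂ : C₂ ≠ ⊤ := ENNReal.mul_ne_top hC₁ (ENNReal.rpow_ne_top_of_nonneg (by positivity)
    (by simp))
  refine ⟨C₀ * (2 * C₂), ENNReal.mul_ne_top hC₀ (ENNReal.mul_ne_top (by simp) hC₂),
    fun m f hf t R ht htR => ?_⟩
  set σ := polarMeasure n t
  have hpt : ∀ x ∈ Metric.sphere (0 : E) t, ∀ y ∈ Metric.sphere (0 : E) t,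
      ‖f x - f y‖ₑ ^ p / edist x y ^ ((n : ℝ) - 1 + s * p) ≤
        C₀ * (nearEnergy p R f x y * edist x y ^ (-a) +
          nearEnergy p R f y x * edist y x ^ (-a)) := by
    intro x hx y hy
    rcases eq_or_ne x y with rfl | hxy
    · simp [hp0]
    have h0 : edist x y ≠ 0 := by simpa using hxy
    have h1 : edist x y ≠ ⊤ := edist_ne_top _ _
    have h := enorm_sub_rpow_mul_le_nearEnergy hf hp ht htR hx hy
    have h2 : ‖f x - f y‖ₑ ^ p * edist x y ^ (n : ℝ) ≤
        C₀ * (nearEnergy p R f x y + nearEnergy p R f y x) := by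
      rw [ENNReal.mul_comm_div, ← mul_div_assoc, ENNReal.le_div_iff_mul_le (Or.inl hv) (Or.inl hv')]
      exact h
    calc ‖f x - f y‖ₑ ^ p / edist x y ^ ((n : ℝ) - 1 + s * p)
        = ‖f x - f y‖ₑ ^ p * edist x y ^ (n : ℝ) * edist x y ^ (-a) := by
          rw [mul_assoc, ← ENNReal.rpow_add _ _ h0 h1, div_eq_mul_inv, ← ENNReal.rpow_neg]
          congr 2; rw [ha_def]; ring
      _ ≤ C₀ * (nearEnergy p R f x y + nearEnergy p R f y x) * edist x y ^ (-a) := by gcongr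
      _ = _ := by rw [edist_comm y x]; ring
  have hK : Measurable fun q : E × E => nearEnergy p R f q.1 q.2 * edist q.1 q.2 ^ (-a) := by
    refine (measurable_nearEnergy hf).mul (by fun_prop)
  -- For fixed `x` and `z`, the condition `|x - z| ≤ 2 |x - y|` cuts the singularity in `y` out,
  -- so integrating in `y` first leaves the kernel of the density.
  have hKy : ∀ x, ∫⁻ y, nearEnergy p R f x y * edist x y ^ (-a) ∂σ ≤
      C₂ * gagliardoDensity s p R f x := by
    intro x
    have hmeas := measurable_nearEnergy_integrand (p := p) hf
    have hin : ∀ z, ∫⁻ y, {z | edist x z ≤ 2 * edist x y}.indicator (fun z => ‖f x - f z‖ₑ ^ p) z *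
        edist x y ^ (-a) ∂σ ≤ C₂ * (‖f x - f z‖ₑ ^ p / edist x z ^ ((n : ℝ) + s * p)) := by
      intro z
      rcases eq_or_ne x z with rfl | hxz
      · simp [indicator, hp0]
      have hd : 0 < dist x z := dist_pos.2 hxz
      have hms : MeasurableSet {y : E | dist x z / 2 ≤ dist x y} :=
        measurableSet_le measurable_const (by fun_prop)
      calc ∫⁻ y, {z | edist x z ≤ 2 * edist x y}.indicator (fun z => ‖f x - f z‖ₑ ^ p) z *
              edist x y ^ (-a) ∂σ
          = ∫⁻ y, ‖f x - f z‖ₑ ^ p *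
              {y : E | dist x z / 2 ≤ dist x y}.indicator (fun y => edist x y ^ (-a)) y ∂σ := by
            refine lintegral_congr fun y => ?_
            have hiff : edist x z ≤ 2 * edist x y ↔ dist x z / 2 ≤ dist x y := by
              have e : 2 * edist x y = ENNReal.ofReal (2 * dist x y) := by
                rw [ENNReal.ofReal_mul (by norm_num), ENNReal.ofReal_ofNat, ← edist_dist]
              rw [e, edist_dist, ENNReal.ofReal_le_ofReal_iff (by positivity),
                div_le_iff₀' (by norm_num)]
            by_cases h : edist x z ≤ 2 * edist x y
            · rw [indicator_of_mem (by exact h), indicator_of_mem (by exact hiff.1 h)]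
            · rw [indicator_of_notMem (by exact h),
                indicator_of_notMem (by exact fun h' => h (hiff.2 h'))]
              simp
        _ = ‖f x - f z‖ₑ ^ p * ∫⁻ y in {y : E | dist x z / 2 ≤ dist x y}, edist x y ^ (-a) ∂σ := by
            rw [lintegral_const_mul _ (Measurable.indicator (by fun_prop) hms),
              lintegral_indicator hms]
        _ ≤ ‖f x - f z‖ₑ ^ p * (C₁ * ENNReal.ofReal (dist x z / 2) ^ (-(n + s * p))) := by
            gcongr
            exact hker t _ x ht (by positivity)
        _ = _ := by
            have e : ENNReal.ofReal (dist x z / 2) = edist x z / 2 := by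
              rw [ENNReal.ofReal_div_of_pos (by norm_num), ENNReal.ofReal_ofNat, edist_dist]
            rw [e, ENNReal.rpow_neg, ENNReal.div_rpow_of_nonneg _ _ (by positivity),
              ENNReal.inv_div (Or.inl (ENNReal.rpow_ne_top_of_nonneg (by positivity) (by simp)))
                (Or.inl (by simp [ENNReal.rpow_eq_zero_iff]))]
            simp only [div_eq_mul_inv, C₂]
            ring
    calc ∫⁻ y, nearEnergy p R f x y * edist x y ^ (-a) ∂σ
        = ∫⁻ y, (∫⁻ z in Metric.ball (0 : E) R,
            {z | edist x z ≤ 2 * edist x y}.indicator (fun z => ‖f x - f z‖ₑ ^ p) z *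
              edist x y ^ (-a)) ∂σ := by
          refine lintegral_congr fun y => ?_
          rw [nearEnergy, lintegral_mul_const]
          exact hmeas.comp (f := fun z : E => ((x, y), z)) (by fun_prop)
      _ = ∫⁻ z in Metric.ball (0 : E) R, ∫⁻ y,
            {z | edist x z ≤ 2 * edist x y}.indicator (fun z => ‖f x - f z‖ₑ ^ p) z *
              edist x y ^ (-a) ∂σ := by
          refine lintegral_lintegral_swap (Measurable.aemeasurable ?_)
          exact (hmeas.comp (f := fun q : E × E => ((x, q.1), q.2)) (by fun_prop)).mul (by fun_prop)
      _ ≤ ∫⁻ z in Metric.ball (0 : E) R,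
            C₂ * (‖f x - f z‖ₑ ^ p / edist x z ^ ((n : ℝ) + s * p)) := lintegral_mono hin
      _ = _ := lintegral_const_mul' _ _ hC₂
  have hsph : ∀ᵐ x ∂σ, x ∈ Metric.sphere (0 : E) t := ae_polarMeasure_mem_sphere ht.le
  calc ∫⁻ x, ∫⁻ y, ‖f x - f y‖ₑ ^ p / edist x y ^ ((n : ℝ) - 1 + s * p) ∂σ ∂σ
      ≤ ∫⁻ x, ∫⁻ y, C₀ * (nearEnergy p R f x y * edist x y ^ (-a) +
          nearEnergy p R f y x * edist y x ^ (-a)) ∂σ ∂σ := by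
        refine lintegral_mono_ae ?_
        filter_upwards [hsph] with x hx
        refine lintegral_mono_ae ?_
        filter_upwards [hsph] with y hy
        exact hpt x hx y hy
    _ = C₀ * ((∫⁻ x, ∫⁻ y, nearEnergy p R f x y * edist x y ^ (-a) ∂σ ∂σ) +
          ∫⁻ x, ∫⁻ y, nearEnergy p R f y x * edist y x ^ (-a) ∂σ ∂σ) := by
        rw [← lintegral_add_left hK.lintegral_prod_right', ← lintegral_const_mul' _ _ hC₀]
        refine lintegral_congr fun x => ?_
        rw [lintegral_const_mul' _ _ hC₀, lintegral_add_left]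
        exact hK.comp (f := fun y : E => (x, y)) (by fun_prop)
    _ = C₀ * (2 * ∫⁻ x, ∫⁻ y, nearEnergy p R f x y * edist x y ^ (-a) ∂σ ∂σ) := by
        rw [lintegral_lintegral_swap (f := fun x y => nearEnergy p R f y x * edist y x ^ (-a))
          (hK.comp measurable_swap).aemeasurable, two_mul]
    _ ≤ C₀ * (2 * ∫⁻ x, C₂ * gagliardoDensity s p R f x ∂σ) := by
        gcongr with x
        exact hKy x
    _ = _ := by
        rw [lintegral_const_mul' _ _ hC₂]
        ring

end Energy

/-! ### Lebesgue points and mollification -/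

section Lebesgue

variable {n m : ℕ} {f g : EuclideanSpace ℝ (Fin n) → EuclideanSpace ℝ (Fin m)} {s p R : ℝ}
  {x : EuclideanSpace ℝ (Fin n)}

local notation "E" => EuclideanSpace ℝ (Fin n)

/-- Where the Gagliardo density is finite, the `L^p` oscillation of `f` around `x` on small balls
decays at a definite rate. -/
theorem setLIntegral_closedBall_le_gagliardoDensity (hs : 0 < s) (hp : 0 < p) {ρ : ℝ}
    (hρ : Metric.closedBall x ρ ⊆ Metric.ball 0 R) :
    ∫⁻ y in Metric.closedBall x ρ, ‖f y - f x‖ₑ ^ p ≤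
      ENNReal.ofReal ρ ^ ((n : ℝ) + s * p) * gagliardoDensity s p R f x := by
  have hb : 0 < (n : ℝ) + s * p := by positivity
  rw [gagliardoDensity, ← lintegral_const_mul' _ _
    (ENNReal.rpow_ne_top_of_nonneg hb.le ENNReal.ofReal_ne_top)]
  refine le_trans ?_ (lintegral_mono_set hρ)
  refine setLIntegral_mono' Metric.isClosed_closedBall.measurableSet fun y hy => ?_
  rcases eq_or_ne x y with rfl | hxy
  · simp [hp]
  have h0 : edist x y ^ ((n : ℝ) + s * p) ≠ 0 := by simp [ENNReal.rpow_eq_zero_iff, hxy, hb.not_gt]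
  have h1 : edist x y ^ ((n : ℝ) + s * p) ≠ ⊤ :=
    ENNReal.rpow_ne_top_of_nonneg hb.le (edist_ne_top _ _)
  have hle : edist x y ≤ ENNReal.ofReal ρ := by
    rw [edist_comm, edist_dist]
    exact ENNReal.ofReal_le_ofReal hy
  rw [← enorm_neg (f y - f x), neg_sub]
  calc ‖f x - f y‖ₑ ^ p = edist x y ^ ((n : ℝ) + s * p) *
        (‖f x - f y‖ₑ ^ p / edist x y ^ ((n : ℝ) + s * p)) := (ENNReal.mul_div_cancel h0 h1).symm
    _ ≤ _ := by gcongr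

theorem isLebesgueValue_of_gagliardoDensity_lt_top (hs : 0 < s) (hp : 0 < p)
    (hx : x ∈ Metric.ball (0 : E) R) (h : gagliardoDensity s p R f x < ⊤) :
    IsLebesgueValue p f x (f x) := by
  have hb : 0 < s * p := by positivity
  set v := volume (Metric.ball (0 : E) 1)
  have hv : v ≠ 0 := (Metric.measure_ball_pos _ _ one_pos).ne'
  obtain ⟨δ, hδ, hδR⟩ := Metric.nhds_basis_closedBall.mem_iff.1 (Metric.isOpen_ball.mem_nhds hx)
  have hlim : Tendsto (fun ρ : ℝ => ENNReal.ofReal ρ ^ (s * p) * (gagliardoDensity s p R f x / v))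
      (𝓝[>] 0) (𝓝 0) := by
    have h1 : Tendsto (fun ρ : ℝ => ENNReal.ofReal ρ ^ (s * p)) (𝓝[>] 0) (𝓝 0) := by
      have : Continuous fun ρ : ℝ => ENNReal.ofReal ρ ^ (s * p) :=
        (ENNReal.continuous_rpow_const).comp ENNReal.continuous_ofReal
      have h2 := this.tendsto 0
      rw [ENNReal.ofReal_zero, ENNReal.zero_rpow_of_pos hb] at h2
      exact h2.mono_left nhdsWithin_le_nhds
    have := ENNReal.Tendsto.mul_const h1 (b := gagliardoDensity s p R f x / v)
      (Or.inr (ENNReal.div_ne_top h.ne hv))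
    rwa [zero_mul] at this
  refine tendsto_of_tendsto_of_tendsto_of_le_of_le' tendsto_const_nhds hlim
    (.of_forall fun _ => zero_le) ?_
  filter_upwards [self_mem_nhdsWithin, mem_nhdsWithin_of_mem_nhds (Iio_mem_nhds hδ)] with ρ hρ hρδ
  have hρ0 : 0 < ρ := hρ
  have hρ1 : ENNReal.ofReal ρ ≠ 0 := by simpa using hρ0
  have h1 := setLIntegral_closedBall_le_gagliardoDensity (f := f) hs hp
    ((Metric.closedBall_subset_closedBall (le_of_lt hρδ)).trans hδR)
  have h2 := (lintegral_mono_set Metric.ball_subset_closedBall).trans h1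
  rw [Measure.addHaar_ball_of_pos _ _ hρ0, finrank_euclideanSpace_fin]
  refine (ENNReal.div_le_div_right h2 _).trans (le_of_eq ?_)
  rw [ENNReal.rpow_add _ _ hρ1 ENNReal.ofReal_ne_top, ENNReal.rpow_natCast,
    ← ENNReal.ofReal_pow hρ0.le, mul_assoc, ENNReal.mul_div_mul_left _ _ (by simp [hρ0])
    ENNReal.ofReal_ne_top, mul_div_assoc]

theorem IsLebesgueValue.unique (hf : Measurable f) (hp : 1 ≤ p) {z z' : EuclideanSpace ℝ (Fin m)}
    (h : IsLebesgueValue p f x z) (h' : IsLebesgueValue p f x z') : z = z' := by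
  have hp0 : 0 < p := by linarith
  have h2 : (2 : ℝ≥0∞) ^ (p - 1) ≠ ⊤ := ENNReal.rpow_ne_top_of_nonneg (by linarith) (by simp)
  have hlim := ENNReal.Tendsto.const_mul (h.add h') (Or.inr h2)
  rw [add_zero, mul_zero] at hlim
  have hle : ‖z - z'‖ₑ ^ p ≤ 0 := by
    refine ge_of_tendsto hlim ?_
    filter_upwards [self_mem_nhdsWithin] with ρ hρ
    have hv : volume (Metric.ball x ρ) ≠ 0 := (Metric.measure_ball_pos _ _ hρ).ne'
    rw [← ENNReal.add_div, ← lintegral_add_left (by fun_prop), ← mul_div_assoc,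
      ENNReal.le_div_iff_mul_le (Or.inl hv) (Or.inl measure_ball_lt_top.ne), ← setLIntegral_const,
      ← lintegral_const_mul' _ _ h2]
    refine lintegral_mono fun y => ?_
    refine le_trans ?_ (ENNReal.rpow_add_le_mul_rpow_add_rpow _ _ hp)
    gcongr
    rw [show z - z' = (f y - z') - (f y - z) by abel, add_comm]
    exact enorm_sub_le
  have h0 : ‖z - z'‖ₑ ^ p = 0 := le_antisymm hle zero_le
  rw [ENNReal.rpow_eq_zero_iff_of_pos hp0, enorm_eq_zero, sub_eq_zero] at h0
  exact h0

theorem preciseRep_eq_of_isLebesgueValue (hf : Measurable f) (hp : 1 ≤ p)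
    {z : EuclideanSpace ℝ (Fin m)} (h : IsLebesgueValue p f x z) : preciseRep p f x = z := by
  have hex : ∃ z, IsLebesgueValue p f x z := ⟨z, h⟩
  rw [preciseRep, dif_pos hex]
  exact hex.choose_spec.unique hf hp h

/-- The quantitative form of the convergence of mollifications: at a point of finite Gagliardo
density the error is `O(ε ^ s)`. -/
theorem exists_enorm_sub_mollify_le {φ : E → ℝ} (hφ : IsStandardMollifier φ) (hs : 0 < s)
    (hp : 1 ≤ p) (hf : Measurable f) (hfi : IntegrableOn f (Metric.ball 0 1)) :
    ∃ M : ℝ≥0∞, M ≠ ⊤ ∧ ∀ (x : E) (ε : ℝ), 0 < ε → Metric.closedBall x ε ⊆ Metric.ball 0 1 →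
      ‖f x - mollify φ f ε x‖ₑ ≤
        M * ENNReal.ofReal ε ^ s * gagliardoDensity s p 1 f x ^ (1 / p) := by
  have hp0 : 0 < p := by linarith
  have hcs : HasCompactSupport φ := by
    refine HasCompactSupport.intro (isCompact_closedBall (0 : E) 1) fun y hy => ?_
    by_contra h
    exact hy (hφ.support_subset h)
  obtain ⟨K, hK⟩ := hcs.exists_bound_of_continuous hφ.contDiff.continuous
  set v := volume (Metric.closedBall (0 : E) 1)
  have hv : v ≠ ⊤ := measure_closedBall_lt_top.ne
  have hexp : 0 ≤ 1 - 1 / p := by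
    rw [sub_nonneg, div_le_one hp0]; exact hp
  refine ⟨ENNReal.ofReal K * v ^ (1 - 1 / p), ENNReal.mul_ne_top ENNReal.ofReal_ne_top
    (ENNReal.rpow_ne_top_of_nonneg hexp hv), fun x ε hε hball => ?_⟩
  set ψ : E → ℝ := fun y => (ε ^ n)⁻¹ * φ (ε⁻¹ • y)
  have hψc : Continuous ψ :=
    continuous_const.mul (hφ.contDiff.continuous.comp (continuous_const_smul _))
  have hψK : ∀ y, ‖ψ y‖ ≤ (ε ^ n)⁻¹ * K := by
    intro y
    rw [norm_mul, Real.norm_of_nonneg (by positivity)]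
    gcongr
    exact hK _
  have hψ0 : ∀ y, ε < ‖y‖ → ψ y = 0 := by
    intro y hy
    have : φ (ε⁻¹ • y) = 0 := by
      by_contra h
      have h1 := hφ.support_subset h
      rw [mem_closedBall_zero_iff, norm_smul, norm_inv, Real.norm_of_nonneg hε.le,
        inv_mul_le_iff₀ hε, mul_one] at h1
      linarith
    simp [ψ, this]
  have hψi : ∫ y, ψ (x - y) = 1 := by
    rw [integral_sub_left_eq_self ψ, integral_const_mul,
      Measure.integral_comp_inv_smul_of_nonneg _ _ hε.le,
      hφ.integral_eq_one, finrank_euclideanSpace_fin, smul_eq_mul, mul_one,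
      inv_mul_cancel₀ (by positivity)]
  -- A function with integral `1` is integrable, as the Bochner integral is `0` otherwise.
  have hψint : Integrable fun y => ψ (x - y) := by
    by_contra h
    rw [integral_undef h] at hψi
    exact zero_ne_one hψi
  set F : E → EuclideanSpace ℝ (Fin m) := (Metric.ball (0 : E) 1).indicator f
  have hFi : Integrable F := (integrable_indicator_iff Metric.isOpen_ball.measurableSet).2 hfi
  have hFint : Integrable fun y => ψ (x - y) • F y :=
    hFi.bdd_smul ((ε ^ n)⁻¹ * K) (by fun_prop) (.of_forall fun y => hψK _)
  have hmoll : mollify φ f ε x = ∫ y, ψ (x - y) • F y := by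
    rw [mollify, convolution_eq_swap]
    rfl
  have hdiff : f x - mollify φ f ε x = ∫ y, ψ (x - y) • (f x - F y) := by
    simp_rw [smul_sub]
    rw [integral_sub (hψint.smul_const _) hFint, integral_smul_const, hψi, one_smul, hmoll]
  have hvol : volume (Metric.closedBall x ε) = ENNReal.ofReal ε ^ (n : ℝ) * v := by
    rw [Measure.addHaar_closedBall' _ _ hε.le, finrank_euclideanSpace_fin, ENNReal.rpow_natCast,
      ENNReal.ofReal_pow hε.le]
  have hε0 : ENNReal.ofReal ε ≠ 0 := by simpa using hε
  have hholder : ∫⁻ y in Metric.closedBall x ε, ‖f y - f x‖ₑ ≤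
      (∫⁻ y in Metric.closedBall x ε, ‖f y - f x‖ₑ ^ p) ^ (1 / p) *
        volume (Metric.closedBall x ε) ^ (1 - 1 / p) := by
    have h := eLpNorm'_le_eLpNorm'_mul_rpow_measure_univ (p := 1) (q := p)
      (μ := volume.restrict (Metric.closedBall x ε)) (f := fun y => f y - f x) one_pos hp
      (by fun_prop)
    simpa [eLpNorm'] using h
  calc ‖f x - mollify φ f ε x‖ₑ ≤ ∫⁻ y, ‖ψ (x - y) • (f x - F y)‖ₑ := by
        rw [hdiff]; exact enorm_integral_le_lintegral_enorm _
    _ ≤ ∫⁻ y, (Metric.closedBall x ε).indicator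
          (fun y => ENNReal.ofReal ((ε ^ n)⁻¹ * K) * ‖f y - f x‖ₑ) y := by
        refine lintegral_mono fun y => ?_
        by_cases hy : y ∈ Metric.closedBall x ε
        · have hFy : F y = f y := indicator_of_mem (hball hy) f
          rw [indicator_of_mem hy, enorm_smul, hFy, ← enorm_neg (f x - f y), neg_sub]
          gcongr
          rw [← ofReal_norm]
          exact ENNReal.ofReal_le_ofReal (hψK _)
        · rw [Metric.mem_closedBall, dist_comm, dist_eq_norm, not_le] at hy
          rw [hψ0 _ hy]
          simp
    _ = ENNReal.ofReal ((ε ^ n)⁻¹ * K) * ∫⁻ y in Metric.closedBall x ε, ‖f y - f x‖ₑ := by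
        rw [lintegral_indicator Metric.isClosed_closedBall.measurableSet,
          lintegral_const_mul' _ _ ENNReal.ofReal_ne_top]
    _ ≤ ENNReal.ofReal ((ε ^ n)⁻¹ * K) *
          ((ENNReal.ofReal ε ^ ((n : ℝ) + s * p) * gagliardoDensity s p 1 f x) ^ (1 / p) *
            (ENNReal.ofReal ε ^ (n : ℝ) * v) ^ (1 - 1 / p)) := by
        rw [← hvol]
        gcongr
        refine hholder.trans ?_
        gcongr
        exact setLIntegral_closedBall_le_gagliardoDensity hs hp0 hball
    _ = _ := by
        rw [ENNReal.mul_rpow_of_nonneg _ _ (by positivity), ENNReal.mul_rpow_of_nonneg _ _ hexp,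
          ← ENNReal.rpow_mul, ← ENNReal.rpow_mul, ENNReal.ofReal_mul (by positivity),
          ENNReal.ofReal_inv_of_pos (by positivity), ENNReal.ofReal_pow hε.le,
          ← ENNReal.rpow_natCast, ← ENNReal.rpow_neg]
        have e : ENNReal.ofReal ε ^ s = ENNReal.ofReal ε ^ (-(n : ℝ)) *
            ENNReal.ofReal ε ^ (((n : ℝ) + s * p) * (1 / p)) *
            ENNReal.ofReal ε ^ ((n : ℝ) * (1 - 1 / p)) := by
          rw [← ENNReal.rpow_add _ _ hε0 ENNReal.ofReal_ne_top,
            ← ENNReal.rpow_add _ _ hε0 ENNReal.ofReal_ne_top]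
          congr 1
          field_simp
          ring
        rw [e]
        ring

/-! ### Dependence on the almost everywhere class -/

theorem isLebesgueValue_congr_ae {U : Set E} (hU : IsOpen U)
    (hfg : f =ᵐ[volume.restrict U] g) (hx : x ∈ U) :
    IsLebesgueValue p f x = IsLebesgueValue p g x := by
  funext z
  obtain ⟨δ, hδ, hδU⟩ := Metric.isOpen_iff.1 hU x hx
  refine propext (tendsto_congr' ?_)
  filter_upwards [mem_nhdsWithin_of_mem_nhds (Iio_mem_nhds hδ)] with ρ hρ
  congr 1
  refine lintegral_congr_ae ?_
  have hsub : Metric.ball x ρ ⊆ U := (Metric.ball_subset_ball (le_of_lt hρ)).trans hδU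
  filter_upwards [ae_restrict_of_ae_restrict_of_subset hsub hfg] with y hy
  rw [hy]

theorem preciseRep_congr_ae {U : Set E} (hU : IsOpen U)
    (hfg : f =ᵐ[volume.restrict U] g) (hx : x ∈ U) : preciseRep p f x = preciseRep p g x := by
  have h := isLebesgueValue_congr_ae (p := p) hU hfg hx
  unfold preciseRep
  generalize IsLebesgueValue p f x = P at h
  subst h
  rfl

theorem singularSet_congr_ae (hfg : f =ᵐ[volume.restrict (Metric.ball (0 : E) 1)] g) :
    singularSet p f = singularSet p g := by
  ext x
  refine and_congr_right fun hx => ?_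
  rw [isLebesgueValue_congr_ae Metric.isOpen_ball hfg hx]

theorem mollify_congr_ae (hfg : f =ᵐ[volume.restrict (Metric.ball (0 : E) 1)] g) (φ : E → ℝ)
    (ε : ℝ) : mollify φ f ε = mollify φ g ε := by
  have h := (ae_eq_restrict_iff_indicator_ae_eq Metric.isOpen_ball.measurableSet).1 hfg
  exact convolution_congr _ .rfl h

theorem gagliardoSphere_congr_ae {t : ℝ} (hfg : f =ᵐ[sphereMeasure n t] g) :
    gagliardoSphere s p t f = gagliardoSphere s p t g := by
  unfold gagliardoSphere
  congr 1
  refine lintegral_congr_ae ?_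
  filter_upwards [hfg] with x hx
  refine lintegral_congr_ae ?_
  filter_upwards [hfg] with y hy
  rw [hx, hy]

theorem gagliardoBall_congr_ae (hfg : f =ᵐ[volume.restrict (Metric.ball (0 : E) R)] g) :
    gagliardoBall s p R f = gagliardoBall s p R g := by
  unfold gagliardoBall
  congr 1
  refine lintegral_congr_ae ?_
  filter_upwards [hfg] with x hx
  refine lintegral_congr_ae ?_
  filter_upwards [hfg] with y hy
  rw [hx, hy]

end Lebesgue

/-! ### Choice of the radii -/

section Slices

variable {n m : ℕ} {f : EuclideanSpace ℝ (Fin n) → EuclideanSpace ℝ (Fin m)} {s p r R : ℝ}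

local notation "E" => EuclideanSpace ℝ (Fin n)

theorem ae_sphereMeasure_mem_sphere (t : ℝ) :
    ∀ᵐ x ∂sphereMeasure n t, x ∈ Metric.sphere (0 : E) t :=
  ae_restrict_mem Metric.isClosed_sphere.measurableSet

/-- A set of positive measure of radii on which the density and `‖f‖ ^ p` have finite spherical
integrals, and on which `e` does not exceed its mean value. -/
theorem exists_radii (hn : 1 ≤ n) (hf : Measurable f) (hp : 0 < p) (hW : MemWsp s p f)
    (hr : 0 < r) (hrR : r < R) (hR : R < 1) {e : ℝ → ℝ≥0∞} (he : Measurable e) :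
    ∃ G ⊆ Ioo r R, MeasurableSet G ∧ 0 < volume G ∧ ∀ t ∈ G,
      ∫⁻ x, gagliardoDensity s p 1 f x ∂polarMeasure n t ≠ ⊤ ∧
      ∫⁻ x, ‖f x‖ₑ ^ p ∂polarMeasure n t ≠ ⊤ ∧
      e t ≤ (∫⁻ τ in Ioo r R, e τ) / ENNReal.ofReal (R - r) := by
  have hfin : ∀ g : E → ℝ≥0∞, Measurable g → ∫⁻ x in Metric.ball (0 : E) 1, g x ≠ ⊤ →
      Measurable (fun t => ∫⁻ x, g x ∂polarMeasure n t) ∧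
      ∀ᵐ t ∂volume.restrict (Ioo r R), ∫⁻ x, g x ∂polarMeasure n t < ⊤ := by
    intro g hg hgi
    have hm : Measurable fun t => ∫⁻ x, g x ∂polarMeasure n t :=
      measurable_lintegral_polarMeasure (g := fun _ => g) (hg.comp measurable_snd) measurable_id
    refine ⟨hm, ae_lt_top hm (ne_top_of_le_ne_top hgi ?_)⟩
    exact (setLIntegral_polarMeasure_le hn hg hr.le).trans
      (lintegral_mono_set (Metric.ball_subset_ball hR.le))
  obtain ⟨hAm, hA⟩ := hfin (gagliardoDensity s p 1 f) (measurable_gagliardoDensity hf) (by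
    rw [← gagliardoBall_rpow hp]
    exact ENNReal.rpow_ne_top_of_nonneg hp.le hW.2.ne)
  obtain ⟨hBm, hB⟩ := hfin (fun x => ‖f x‖ₑ ^ p) (by fun_prop) (by
    have h := lintegral_rpow_enorm_lt_top_of_eLpNorm_lt_top (by simpa using hp)
      ENNReal.ofReal_ne_top hW.1.2
    rw [ENNReal.toReal_ofReal hp.le] at h
    exact h.ne)
  have hI : volume (Ioo r R) = ENNReal.ofReal (R - r) := Real.volume_Ioo
  have hpos := measure_le_setLAverage_pos (μ := volume) (s := Ioo r R) (f := e)
    (by simp [hI, hrR]) (by simp [hI]) he.aemeasurable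
  rw [setLAverage_eq, hI] at hpos
  refine ⟨Ioo r R ∩ ({t | ∫⁻ x, gagliardoDensity s p 1 f x ∂polarMeasure n t < ⊤} ∩
    {t | ∫⁻ x, ‖f x‖ₑ ^ p ∂polarMeasure n t < ⊤} ∩
    {t | e t ≤ (∫⁻ τ in Ioo r R, e τ) / ENNReal.ofReal (R - r)}), inter_subset_left,
    measurableSet_Ioo.inter (((measurableSet_lt hAm measurable_const).inter
      (measurableSet_lt hBm measurable_const)).inter (measurableSet_le he measurable_const)),
    hpos.trans_le (measure_mono_ae ?_), fun t ht => ⟨ht.2.1.1.ne, ht.2.1.2.ne, ht.2.2⟩⟩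
  filter_upwards [(ae_restrict_iff' measurableSet_Ioo).1 hA,
    (ae_restrict_iff' measurableSet_Ioo).1 hB] with t h1 h2 ht
  exact ⟨ht.1, ⟨h1 ht.1, h2 ht.1⟩, ht.2⟩

/-- The three assertions for a measurable representative; the general case differs from it only
on a null set of `B_1`. -/
theorem exists_slices_of_measurable (hn : 1 ≤ n) (hs : 0 < s) (hp : 1 < p) :
    ∃ C : ℝ, 0 < C ∧
      ∀ (m : ℕ) (φ : E → ℝ), IsStandardMollifier φ →
      ∀ f : E → EuclideanSpace ℝ (Fin m), Measurable f → MemWsp s p f →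
      ∀ r R : ℝ, 0 < r → r < R → R < 1 →
      ∃ G : Set ℝ, G ⊆ Set.Ioo r R ∧ MeasurableSet G ∧ 0 < volume G ∧
        ∀ t ∈ G,
          μHE[n - 1] (singularSet p f ∩ Metric.sphere 0 t) = 0 ∧
          (MemLp (preciseRep p f) (ENNReal.ofReal p) (sphereMeasure n t) ∧
            Tendsto
              (fun ε : ℝ => eLpNorm (preciseRep p f - mollify φ f ε) (ENNReal.ofReal p)
                (sphereMeasure n t))
              (𝓝[>] 0) (𝓝 0)) ∧
          gagliardoSphere s p t (preciseRep p f) ≤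
            ENNReal.ofReal (C * (R - r) ^ (-(1 / p))) * gagliardoBall s p R f := by
  have hp0 : 0 < p := by linarith
  obtain ⟨K, hK, hσ⟩ := exists_sphereMeasure_le_smul_polarMeasure hn
  obtain ⟨C₁, hC₁, henergy⟩ := exists_lintegral_polarMeasure_gagliardo_le hn hs hp.le
  have hL : K * K * C₁ ≠ ⊤ := ENNReal.mul_ne_top (ENNReal.mul_ne_top hK hK) hC₁
  -- The summand `1` only makes the constant positive.
  refine ⟨(K * K * C₁).toReal ^ (1 / p) + 1, by positivity, fun m φ hφ f hf hW r R hr hrR hR => ?_⟩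
  set e : ℝ → ℝ≥0∞ := fun t =>
    ∫⁻ x, ∫⁻ y, ‖f x - f y‖ₑ ^ p / edist x y ^ ((n : ℝ) - 1 + s * p) ∂polarMeasure n t
      ∂polarMeasure n t
  have he : Measurable e := by
    refine measurable_lintegral_polarMeasure (g := fun t x => ∫⁻ y, ‖f x - f y‖ₑ ^ p /
      edist x y ^ ((n : ℝ) - 1 + s * p) ∂polarMeasure n t) ?_ measurable_id
    refine measurable_lintegral_polarMeasure (α := ℝ × E) (τ := Prod.fst)
      (g := fun q y => ‖f q.2 - f y‖ₑ ^ p / edist q.2 y ^ ((n : ℝ) - 1 + s * p)) ?_ measurable_fst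
    unfold Function.uncurry
    fun_prop
  have heint : ∫⁻ t in Ioo r R, e t ≤ C₁ * gagliardoBall s p R f ^ p := by
    calc ∫⁻ t in Ioo r R, e t
        ≤ ∫⁻ t in Ioo r R, C₁ * ∫⁻ x, gagliardoDensity s p R f x ∂polarMeasure n t :=
          setLIntegral_mono' measurableSet_Ioo fun t ht =>
            henergy m f hf t R (hr.trans ht.1) ht.2
      _ = C₁ * ∫⁻ t in Ioo r R, ∫⁻ x, gagliardoDensity s p R f x ∂polarMeasure n t :=
          lintegral_const_mul' _ _ hC₁
      _ ≤ _ := by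
          rw [gagliardoBall_rpow hp0]
          gcongr
          exact setLIntegral_polarMeasure_le hn (measurable_gagliardoDensity hf) hr.le
  obtain ⟨G, hGI, hGm, hG0, hG⟩ := exists_radii hn hf hp0 hW hr hrR hR he
  refine ⟨G, hGI, hGm, hG0, fun t htG => ?_⟩
  obtain ⟨hA, hB, hE⟩ := hG t htG
  have ht : 0 < t := hr.trans (hGI htG).1
  have ht1 : t < 1 := (hGI htG).2.trans hR
  have hσt := hσ t ht
  have hlin : ∀ g : E → ℝ≥0∞, ∫⁻ x, g x ∂sphereMeasure n t ≤ K * ∫⁻ x, g x ∂polarMeasure n t := by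
    intro g
    rw [← smul_eq_mul, ← lintegral_smul_measure]
    exact lintegral_mono' hσt le_rfl
  have hAs : ∫⁻ x, gagliardoDensity s p 1 f x ∂sphereMeasure n t ≠ ⊤ :=
    ne_top_of_le_ne_top (ENNReal.mul_ne_top hK hA) (hlin _)
  have hfinite : ∀ᵐ x ∂sphereMeasure n t, gagliardoDensity s p 1 f x < ⊤ :=
    ae_lt_top (measurable_gagliardoDensity hf) hAs
  have hmem := ae_sphereMeasure_mem_sphere (n := n) t
  have hball : ∀ x ∈ Metric.sphere (0 : E) t, x ∈ Metric.ball (0 : E) 1 :=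
    fun x hx => Metric.sphere_subset_ball ht1 hx
  have hrep : preciseRep p f =ᵐ[sphereMeasure n t] f := by
    filter_upwards [hfinite, hmem] with x hx hxt
    exact preciseRep_eq_of_isLebesgueValue hf hp.le
      (isLebesgueValue_of_gagliardoDensity_lt_top hs hp0 (hball x hxt) hx)
  have hpe : ENNReal.ofReal p ≠ 0 := by simpa using hp0
  have hnorm : ∀ g : E → EuclideanSpace ℝ (Fin m),
      eLpNorm g (ENNReal.ofReal p) (sphereMeasure n t) =
        (∫⁻ x, ‖g x‖ₑ ^ p ∂sphereMeasure n t) ^ (1 / p) := by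
    intro g
    rw [eLpNorm_eq_lintegral_rpow_enorm_toReal hpe ENNReal.ofReal_ne_top,
      ENNReal.toReal_ofReal hp0.le]
  refine ⟨?_, ⟨?_, ?_⟩, ?_⟩
  · rw [← Measure.restrict_apply' Metric.isClosed_sphere.measurableSet]
    refine measure_mono_null ?_ (ae_iff.1 hfinite)
    intro x hx hx'
    exact hx.2 ⟨f x, isLebesgueValue_of_gagliardoDensity_lt_top hs hp0 hx.1 hx'⟩
  · rw [memLp_congr_ae hrep]
    refine ⟨hf.aestronglyMeasurable, ?_⟩
    rw [hnorm]
    refine ENNReal.rpow_lt_top_of_nonneg (by positivity) ?_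
    exact ne_top_of_le_ne_top (ENNReal.mul_ne_top hK hB) (hlin _)
  · have hfi : IntegrableOn f (Metric.ball 0 1) := by
      have : IsFiniteMeasure ((volume : Measure E).restrict (Metric.ball 0 1)) :=
        ⟨by simpa using measure_ball_lt_top⟩
      exact hW.1.integrable (by simpa using hp.le)
    obtain ⟨M, hM, hmoll⟩ := exists_enorm_sub_mollify_le hφ hs hp.le hf hfi
    set I := ∫⁻ x, gagliardoDensity s p 1 f x ∂sphereMeasure n t
    have hlim : Tendsto (fun ε : ℝ => M * ENNReal.ofReal ε ^ s * I ^ (1 / p)) (𝓝[>] 0) (𝓝 0) := by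
      have h1 : Continuous fun ε : ℝ => ENNReal.ofReal ε ^ s :=
        (ENNReal.continuous_rpow_const).comp ENNReal.continuous_ofReal
      have h2 := h1.tendsto 0
      rw [ENNReal.ofReal_zero, ENNReal.zero_rpow_of_pos hs] at h2
      have h3 := ENNReal.Tendsto.mul_const (ENNReal.Tendsto.const_mul
        (h2.mono_left (nhdsWithin_le_nhds (s := Ioi 0))) (Or.inr hM)) (b := I ^ (1 / p))
        (Or.inr (ENNReal.rpow_ne_top_of_nonneg (by positivity) hAs))
      simpa using h3
    refine tendsto_of_tendsto_of_tendsto_of_le_of_le' tendsto_const_nhds hlim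
      (.of_forall fun _ => zero_le) ?_
    filter_upwards [self_mem_nhdsWithin,
      mem_nhdsWithin_of_mem_nhds (Iio_mem_nhds (sub_pos.2 ht1))] with ε hε hεt
    have hε0 : 0 < ε := hε
    have hεt' : ε < 1 - t := hεt
    have hMs : M * ENNReal.ofReal ε ^ s ≠ ⊤ :=
      ENNReal.mul_ne_top hM (ENNReal.rpow_ne_top_of_nonneg hs.le ENNReal.ofReal_ne_top)
    rw [hnorm]
    calc (∫⁻ x, ‖(preciseRep p f - mollify φ f ε) x‖ₑ ^ p ∂sphereMeasure n t) ^ (1 / p)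
        ≤ (∫⁻ x, (M * ENNReal.ofReal ε ^ s) ^ p * gagliardoDensity s p 1 f x
            ∂sphereMeasure n t) ^ (1 / p) := by
          refine ENNReal.rpow_le_rpow (lintegral_mono_ae ?_) (by positivity)
          filter_upwards [hrep, hmem] with x hx hxt
          have hsub : Metric.closedBall x ε ⊆ Metric.ball 0 1 := by
            intro y hy
            rw [Metric.mem_closedBall] at hy
            rw [mem_sphere_iff_norm, sub_zero] at hxt
            rw [mem_ball_zero_iff]
            have := norm_le_norm_add_norm_sub' y x
            rw [← dist_eq_norm] at this
            linarith
          have h := ENNReal.rpow_le_rpow (hmoll x ε hε0 hsub) hp0.le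
          rw [ENNReal.mul_rpow_of_nonneg _ (_ ^ (1 / p)) hp0.le, ← ENNReal.rpow_mul, one_div,
            inv_mul_cancel₀ hp0.ne', ENNReal.rpow_one] at h
          rwa [Pi.sub_apply, hx]
      _ = M * ENNReal.ofReal ε ^ s * I ^ (1 / p) := by
          rw [lintegral_const_mul' _ _ (ENNReal.rpow_ne_top_of_nonneg hp0.le hMs),
            ENNReal.mul_rpow_of_nonneg _ _ (by positivity), ← ENNReal.rpow_mul,
            mul_one_div_cancel hp0.ne', ENNReal.rpow_one]
  · rw [gagliardoSphere_congr_ae hrep]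
    have hRr : 0 < R - r := sub_pos.2 hrR
    have h1 : ∫⁻ x, ∫⁻ y, ‖f x - f y‖ₑ ^ p / edist x y ^ ((n : ℝ) - 1 + s * p)
        ∂sphereMeasure n t ∂sphereMeasure n t ≤
        K * K * C₁ * (gagliardoBall s p R f ^ p / ENNReal.ofReal (R - r)) := by
      calc ∫⁻ x, ∫⁻ y, ‖f x - f y‖ₑ ^ p / edist x y ^ ((n : ℝ) - 1 + s * p)
            ∂sphereMeasure n t ∂sphereMeasure n t
          ≤ ∫⁻ x, K * ∫⁻ y, ‖f x - f y‖ₑ ^ p / edist x y ^ ((n : ℝ) - 1 + s * p)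
            ∂polarMeasure n t ∂sphereMeasure n t := lintegral_mono fun x => hlin _
        _ ≤ K * (K * e t) := by
            rw [lintegral_const_mul' _ _ hK]
            gcongr
            exact hlin _
        _ ≤ K * (K * (C₁ * gagliardoBall s p R f ^ p / ENNReal.ofReal (R - r))) := by
            gcongr
            exact hE.trans (by gcongr)
        _ = _ := by rw [mul_div_assoc]; ring
    calc gagliardoSphere s p t f
        ≤ (K * K * C₁ * (gagliardoBall s p R f ^ p / ENNReal.ofReal (R - r))) ^ (1 / p) :=
          ENNReal.rpow_le_rpow h1 (by positivity)
      _ = ENNReal.ofReal ((K * K * C₁).toReal ^ (1 / p) * (R - r) ^ (-(1 / p))) *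
            gagliardoBall s p R f := by
          rw [ENNReal.mul_rpow_of_nonneg _ _ (by positivity),
            ENNReal.div_rpow_of_nonneg _ _ (by positivity), ← ENNReal.rpow_mul,
            mul_one_div_cancel hp0.ne', ENNReal.rpow_one, ENNReal.ofReal_mul (by positivity),
            ← ENNReal.ofReal_rpow_of_nonneg ENNReal.toReal_nonneg (by positivity),
            ENNReal.ofReal_toReal hL, ← ENNReal.ofReal_rpow_of_pos hRr, ENNReal.rpow_neg,
            ENNReal.div_eq_inv_mul, ← mul_assoc]
      _ ≤ _ := by
          gcongr
          linarith

end Slices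

theorem mainTheorem5 (n : ℕ) (hn : 1 ≤ n) (s p : ℝ) (hs : s ∈ Set.Ioo (0 : ℝ) 1) (hp : 1 < p) :
    ∃ C : ℝ, 0 < C ∧
      ∀ (m : ℕ) (φ : EuclideanSpace ℝ (Fin n) → ℝ), IsStandardMollifier φ →
      ∀ f : EuclideanSpace ℝ (Fin n) → EuclideanSpace ℝ (Fin m), MemWsp s p f →
      ∀ r R : ℝ, 0 < r → r < R → R < 1 → R ≤ 100 * r →
      ∃ G : Set ℝ, G ⊆ Set.Ioo r R ∧ MeasurableSet G ∧ 0 < volume G ∧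
        ∀ t ∈ G,
          -- (a) almost every point of the sphere is a Lebesgue point
          μHE[n - 1] (singularSet p f ∩ Metric.sphere 0 t) = 0 ∧
          -- (b) convergence of the mollifications in `L^p` of the sphere
          (MemLp (preciseRep p f) (ENNReal.ofReal p) (sphereMeasure n t) ∧
            Tendsto
              (fun ε : ℝ => eLpNorm (preciseRep p f - mollify φ f ε) (ENNReal.ofReal p)
                (sphereMeasure n t))
              (𝓝[>] 0) (𝓝 0)) ∧
          -- (c) the bound on the seminorm
          gagliardoSphere s p t (preciseRep p f) ≤
            ENNReal.ofReal (C * (R - r) ^ (-(1 / p))) * gagliardoBall s p R f := by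
  obtain ⟨C, hC, h⟩ := exists_slices_of_measurable hn hs.1 hp
  refine ⟨C, hC, fun m φ hφ f hW r R hr hrR hR _ => ?_⟩
  obtain ⟨g, hgm, hfg⟩ := hW.1.1.aemeasurable
  have hWg : MemWsp s p g :=
    ⟨(memLp_congr_ae hfg).1 hW.1, by rw [← gagliardoBall_congr_ae hfg]; exact hW.2⟩
  obtain ⟨G, hGI, hGm, hG0, hG⟩ := h m φ hφ g hgm hWg r R hr hrR hR
  refine ⟨G, hGI, hGm, hG0, fun t ht => ?_⟩
  obtain ⟨ha, ⟨hb, hb'⟩, hc⟩ := hG t ht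
  have hrep : preciseRep p f =ᵐ[sphereMeasure n t] preciseRep p g := by
    filter_upwards [ae_sphereMeasure_mem_sphere (n := n) t] with x hx
    exact preciseRep_congr_ae Metric.isOpen_ball hfg
      (Metric.sphere_subset_ball ((hGI ht).2.trans hR) hx)
  refine ⟨by rwa [singularSet_congr_ae hfg], ⟨(memLp_congr_ae hrep).2 hb, ?_⟩, ?_⟩
  · refine hb'.congr fun ε => eLpNorm_congr_ae ?_
    rw [mollify_congr_ae hfg]
    exact hrep.symm.sub .rfl
  · rw [gagliardoSphere_congr_ae hrep, gagliardoBall_congr_ae (R := R) (f := f)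
      (ae_restrict_of_ae_restrict_of_subset (Metric.ball_subset_ball hR.le) hfg)]
    exact hc
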